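/- **Setting.** A *polyhedral polynomial* is a formal expression $\phi=\bigoplus_{i\in S}Q_i\odot Y^i$, where $S=\mathrm{Supp}(\phi)\subset\mathbb{Z}_{\ge 0}$ is finite and non-empty and each $Q_i\subseteq\mathbb{R}^n$ is a non-empty convex polyhedron; $\oplus$ stands for convex hull and $\odot$ for Minkowski sum. Assume $0\notin S$ (no constant term). For a polyhedron $P$ and a vertex $p$ of $P$, let $N_P(p)=\{\ell\in(\mathbb{R}^n)^\star \mid \ell(p)\le\ell(x)\ \forall x\in P\}$, and let $N(P)$ be the union of the cones $N_P(p)$ over all vertices $p$. Let $M$ be the Minkowski sum of the $Q_i$, $i\in S$. Each vertex $\nu$ of $M$ is uniquely $\nu=\sum_{i\in S}\nu_i$ with $\nu_i$ a vertex of $Q_i$; for distinct $i,j\in S$ put $\rho^{(\nu)}_{i,j}=-(\nu_i-\nu_j)/(i-j)$. The polynomial $\phi$ is *generic* if for every vertex $\nu$ of $M$, $\rho^{(\nu)}_{i,j}=\rho^{(\nu)}_{i',j'}$ implies $\{i,j\}=\{i',j'\}$. **Vertex-cone collections.** A *vertex-cone collection* (VCC) is $\mathfrak{G}=\{(u,N_{\mathfrak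 G}(u))\}_{u\in G}$ with $G\subset\mathbb{R}^n$ finite and non-empty (the *vertices*) and each $N_{\mathfrak G}(u)\subseteq(\mathbb{R}^n)^\star$ a full-dimensional convex polyhedral cone, such that $\ell(u)\le\ell(u')$ for all distinct $u,u'\in G$ and $\ell\in N_{\mathfrak G}(u)$. Its *support* is $\mathrm{Supp}(\mathfrak G)=\bigcup_{u}N_{\mathfrak G}(u)$. Two VCCs are equal if they have the same vertices with the same cones. A polyhedron $Q$ having a vertex gives the VCC of its vertices and their inner normal cones; let $\mathfrak{Q}_i$ be the one of $Q_i$. If $\mathrm{Supp}(\mathfrak G_1)\cap\mathrm{Supp}(\mathfrak G_2)$ is full-dimensional, $\mathfrak G_1\odot\mathfrak G_2$ has as vertices the sums $u_1+u_2$ for which $N_{\mathfrak G_1}(u_1)\cap N_{\mathfrak G_2}(u_2)$ is full-dimensional, with that intersection as the cone. If $\mathrm{Supp}(\mathfrak G_1)=\mathrm{Supp}(\mathfrak G_2)$, $\mathfrak G_1\oplus\mathfrak G_2$ has as vertices (a) the common vertices $u$ with $N_{\mathfrak G_1}(u)\cap N_{\mathfrak G_2}(u)$ full-dimensional, with this cone,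 and (b) the vertices $u$ of one $\mathfrak G_a$ that are not vertices of the other one $\mathfrak G_b$ and for which some $\ell$ in the interior of $N_{\mathfrak G_a}(u)$ satisfies $\ell(u)<\ell(u')$ for all vertices $u'$ of $\mathfrak G_b$, with cone $\{\ell\in N_{\mathfrak G_a}(u)\mid\ell(u)\le\ell(u')\text{ for all vertices }u'\text{ of }\mathfrak G_b\}$. If $\mathrm{Supp}(\mathfrak P)\subseteq\bigcap_{i\in S} N(Q_i)$, put $\phi(\mathfrak P)=\bigoplus_{i\in S}\mathfrak Q_i\odot\mathfrak P^{\odot i}$. Such a VCC $\mathfrak P$ is a *solution* (root) of $\phi$ if every vertex of $\phi(\mathfrak P)$ is a vertex of $\mathfrak Q_i\odot\mathfrak P^{\odot i}$ and of $\mathfrak Q_j\odot\mathfrak P^{\odot j}$ for some distinct $i,j\in S$. Fix a vertex $v$ of $M$. A solution is *$v$-local* if its support is contained in $N_M(v)$. A $v$-local solution is *Minkowski–Weyl minimal* if its support is maximal under inclusion among the supports of all $v$-local solutions with the same vertex set. **Local compatible systems.** Let $\mathcal F_v$ be the fan obtained by subdividing $N_M(v)$ by all the hyperplanes $\{\mu\mid\mu(v_k+k\rho^{(v)}_{i,j})=\mu(v_i+i\rho^{(v)}_{i,j})\}$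 and $\{\mu\mid\mu(\rho^{(v)}_{i,j})=\mu(\rho^{(v)}_{i',j'})\}$ ($i,j,i',j',k\in S$, $i\ne j$, $i'\neq j'$) that are not the whole space. A maximal cone $C$ of $\mathcal F_v$ has *primary label* $(i,j)$ if $\mu(v_i+i\rho^{(v)}_{i,j})\le\mu(v_k+k\rho^{(v)}_{i,j})$ for all $k\in S$, $\mu\in C$, and *secondary label* $(i,j,i',j')$ if $\mu(\rho^{(v)}_{i,j})\le\mu(\rho^{(v)}_{i',j'})$ for all $\mu\in C$. A *local compatible system* at $v$ is a set of distinct maximal cones $C_1,\dots,C_t$ of $\mathcal F_v$ with pairs $(i_1,j_1),\dots,(i_t,j_t)$ of distinct elements of $S$ such that: 1. for each $\gamma\in\mathfrak T:=\{\rho^{(v)}_{i_k,j_k}\}_{k=1}^t$, the union $C_\gamma$ of the $C_k$ with $\rho^{(v)}_{i_k,j_k}=\gamma$ is a convex polyhedral cone; 2. $(i_k,j_k)$ is a primary label of $C_k$ for each $k$; 3. $(i_\alpha,j_\alpha,i_\beta,j_\beta)$ is a secondary label of $C_\alpha$ for all $\alpha\neq\beta$; 4. whenever $\mathfrak f$ is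 a facet of exactly one cone $C_l$ of the system and also a facet of a maximal cone $C$ of $\mathcal F_v$ that is not in the system, either $(i_l,j_l)$ is not a primary label of $C$, or for some $\beta$ the tuple $(i_l,j_l,i_\beta,j_\beta)$ is not a secondary label of $C$. Its *support* is $\bigcup_k C_k$ and its *associated vertex-cone collection* is $\{(\gamma,C_\gamma)\}_{\gamma\in\mathfrak T}$. **Theorem (Generic-Local VCC Case).** Let $\phi$ be a generic polyhedral polynomial with $0\notin\mathrm{Supp}(\phi)$, and let $v$ be a vertex of $M$. A vertex-cone collection $\mathfrak P$ with $\mathrm{Supp}(\mathfrak P)\subseteq N_M(v)$ is a Minkowski–Weyl minimal $v$-local solution to $\phi$ if and only if it is the associated vertex-cone collection of a local compatible system of $\phi$ at $v$ whose support is contained in $N_M(v)$. -/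

import Mathlib

open scoped Pointwise

namespace PolyRoot

/-! Throughout, `W` is a finite dimensional real vector space (in the theorem `ℝⁿ`), and its dual
space `W*` is `StrongDual ℝ W`, the space of (automatically continuous) linear functionals. -/

section Polyhedra

variable {W : Type*} [NormedAddCommGroup W] [NormedSpace ℝ W]

/-- A convex polyhedron: an intersection of finitely many closed half-spaces. -/
def IsPolyhedron (P : Set W) : Prop :=
  ∃ (m : ℕ) (a : Fin m → StrongDual ℝ W) (b : Fin m → ℝ), P = {x | ∀ k, b k ≤ a k x}

/-- A vertex of `P`: the unique minimiser over `P` of some linear functional. -/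
def IsVertex (P : Set W) (p : W) : Prop :=
  p ∈ P ∧ ∃ l : StrongDual ℝ W, ∀ x ∈ P, x ≠ p → l p < l x

/-- The inner normal cone `N_P(p)`: the functionals minimised over `P` at `p`. -/
def normalCone (P : Set W) (p : W) : Set (StrongDual ℝ W) :=
  {l | ∀ x ∈ P, l p ≤ l x}

/-- The inner normal cone `N(P)` of `P`: the union of the inner normal cones of its vertices. -/
def innerNormal (P : Set W) : Set (StrongDual ℝ W) :=
  {l | ∃ p, IsVertex P p ∧ l ∈ normalCone P p}

/-- A convex polyhedral cone in `W*`: the solution set of finitely many homogeneous linear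
inequalities. -/
def IsPolyhedralCone (C : Set (StrongDual ℝ W)) : Prop :=
  ∃ S : Set W, S.Finite ∧ C = {l | ∀ x ∈ S, 0 ≤ l x}

/-- Full-dimensionality of a convex set in the dual space. -/
def FullDim (C : Set (StrongDual ℝ W)) : Prop := (interior C).Nonempty

/-- `f` is a facet of the (full-dimensional) convex cone `C`: a face, cut out by a valid
inequality, of dimension one less than that of the ambient space. -/
def IsFacet (f C : Set (StrongDual ℝ W)) : Prop :=
  (∃ x : W, (∀ l ∈ C, 0 ≤ l x) ∧ f = {l ∈ C | l x = 0}) ∧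
    Module.finrank ℝ (Submodule.span ℝ f) + 1 = Module.finrank ℝ W

end Polyhedra

/-- Raw data of a collection `{(v, N(v))}`, indexed by a set of points. Only the values of `cone`
at points of `verts` are meaningful. -/
structure ConeCollection (W : Type*) [NormedAddCommGroup W] [NormedSpace ℝ W] where
  verts : Set W
  cone : W → Set (StrongDual ℝ W)

namespace ConeCollection

variable {W : Type*} [NormedAddCommGroup W] [NormedSpace ℝ W]

/-- Vertex-cone collections (VCC). -/
structure IsVCC (G : ConeCollection W) : Prop where
  nonempty : G.verts.Nonempty
  finite : G.verts.Finite
  polyhedral : ∀ v ∈ G.verts, IsPolyhedralCone (G.cone v)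
  fullDim : ∀ v ∈ G.verts, FullDim (G.cone v)
  le : ∀ v ∈ G.verts, ∀ u ∈ G.verts, v ≠ u → ∀ l ∈ G.cone v, l v ≤ l u

/-- The support: the union of the normal cones of the vertices. -/
def support (G : ConeCollection W) : Set (StrongDual ℝ W) :=
  {l | ∃ v ∈ G.verts, l ∈ G.cone v}

/-- Equality of collections: same vertices, with the same cones. -/
def SameAs (G₁ G₂ : ConeCollection W) : Prop :=
  G₁.verts = G₂.verts ∧ ∀ v ∈ G₁.verts, G₁.cone v = G₂.cone v

/-- The collection associated with a polyhedron: its vertices with their inner normal cones. -/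
def ofPolyhedron (P : Set W) : ConeCollection W where
  verts := {p | IsVertex P p}
  cone := normalCone P

/-- The convex hull `G₁ ⊕ G₂` (meant for VCCs with equal supports). -/
def hull (G₁ G₂ : ConeCollection W) : ConeCollection W where
  verts := {v |
    (v ∈ G₁.verts ∧ v ∈ G₂.verts ∧ FullDim (G₁.cone v ∩ G₂.cone v)) ∨
    (v ∈ G₁.verts ∧ v ∉ G₂.verts ∧ ∃ l ∈ interior (G₁.cone v), ∀ u ∈ G₂.verts, l v < l u) ∨
    (v ∈ G₂.verts ∧ v ∉ G₁.verts ∧ ∃ l ∈ interior (G₂.cone v), ∀ u ∈ G₁.verts, l v < l u)}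
  cone v := {l |
    (v ∈ G₁.verts ∧ v ∈ G₂.verts ∧ l ∈ G₁.cone v ∧ l ∈ G₂.cone v) ∨
    (v ∈ G₁.verts ∧ v ∉ G₂.verts ∧ l ∈ G₁.cone v ∧ ∀ u ∈ G₂.verts, l v ≤ l u) ∨
    (v ∈ G₂.verts ∧ v ∉ G₁.verts ∧ l ∈ G₂.cone v ∧ ∀ u ∈ G₁.verts, l v ≤ l u)}

/-- The Minkowski sum `G₁ ⊙ G₂` (meant for VCCs whose supports have full-dimensional
intersection). For VCCs the decomposition `w = v₁ + v₂` with `N(v₁) ∩ N(v₂)` full-dimensional is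
unique, so the cone of `w` is `N(v₁) ∩ N(v₂)` for that decomposition. -/
def msum (G₁ G₂ : ConeCollection W) : ConeCollection W where
  verts := {w | ∃ v₁ ∈ G₁.verts, ∃ v₂ ∈ G₂.verts,
    FullDim (G₁.cone v₁ ∩ G₂.cone v₂) ∧ w = v₁ + v₂}
  cone w := {l | ∃ v₁ ∈ G₁.verts, ∃ v₂ ∈ G₂.verts,
    FullDim (G₁.cone v₁ ∩ G₂.cone v₂) ∧ w = v₁ + v₂ ∧ l ∈ G₁.cone v₁ ∧ l ∈ G₂.cone v₂}

/-- The iterated Minkowski sum `G ⊙ ⋯ ⊙ G` (`k` factors; for `k = 0` the neutral collection, the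
origin with the whole dual space as its cone). -/
def mpow (G : ConeCollection W) : ℕ → ConeCollection W
  | 0 => ⟨{0}, fun _ => Set.univ⟩
  | 1 => G
  | k + 2 => msum (mpow G (k + 1)) G

/-- The iterated convex hull `G₁ ⊕ (G₂ ⊕ (⋯ ⊕ G_m))` of a list of collections. -/
def hullList : List (ConeCollection W) → ConeCollection W
  | [] => ⟨∅, fun _ => ∅⟩
  | [G] => G
  | G :: G' :: Gs => hull G (hullList (G' :: Gs))

end ConeCollection

/-- A polyhedral polynomial `⊕_{i ∈ supp} Q_i ⊙ Y^i` in one variable. Its coefficients `Q_i` are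
arbitrary non-empty polyhedra in `W`. -/
structure PolyhedralPolynomial (W : Type*) [NormedAddCommGroup W] [NormedSpace ℝ W] where
  supp : Finset ℕ
  supp_nonempty : supp.Nonempty
  coeff : ℕ → Set W
  isPolyhedron : ∀ i ∈ supp, IsPolyhedron (coeff i)
  coeff_nonempty : ∀ i ∈ supp, (coeff i).Nonempty

namespace PolyhedralPolynomial

variable {W : Type*} [NormedAddCommGroup W] [NormedSpace ℝ W] (φ : PolyhedralPolynomial W)

/-- The Minkowski sum `M` of the coefficients. -/
def M : Set W := ∑ i ∈ φ.supp, φ.coeff i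

/-- `d` is a Minkowski decomposition of `v`: `v = ∑ d i` with `d i` a vertex of `Q_i`. -/
def IsDecomp (v : W) (d : ℕ → W) : Prop :=
  (∀ i ∈ φ.supp, IsVertex (φ.coeff i) (d i)) ∧ ∑ i ∈ φ.supp, d i = v

/-- Every vertex of `M` has a Minkowski decomposition, and it is unique. -/
theorem exists_decomp {v : W} (hv : IsVertex φ.M v) :
    ∃ d, φ.IsDecomp v d ∧ ∀ d', φ.IsDecomp v d' → ∀ i ∈ φ.supp, d' i = d i := by
  classical
  obtain ⟨hvM, l, hl⟩ := hv
  obtain ⟨d, hd, hsum⟩ := (Set.mem_finsetSum _ _ _).1 hvM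
  have hd' : ∀ i ∈ φ.supp, d i ∈ φ.coeff i := fun i hi => hd hi
  have key : ∀ i ∈ φ.supp, ∀ x ∈ φ.coeff i, x ≠ d i → l (d i) < l x := by
    intro i hi x hx hne
    have hs : ∑ k ∈ φ.supp, Function.update d i x k = v - d i + x := by
      rw [← hsum, Finset.sum_update_of_mem hi, ← Finset.sum_sdiff
        (Finset.singleton_subset_iff.2 hi)]
      simp [add_comm]
    have hmem : v - d i + x ∈ φ.M := by
      refine (Set.mem_finsetSum _ _ _).2 ⟨Function.update d i x, ?_, hs⟩
      intro k hk
      by_cases h : k = i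
      · subst h; simpa using hx
      · simpa [h] using hd' k hk
    have := hl _ hmem (by
      intro h
      apply hne
      have h2 : x = v - (v - d i) := eq_sub_of_add_eq' h
      simpa using h2)
    simp only [map_add, map_sub] at this
    linarith
  refine ⟨d, ⟨fun i hi => ⟨hd' i hi, l, key i hi⟩, hsum⟩, ?_⟩
  intro d' hdec i hi
  by_contra hne
  have hle : ∀ k ∈ φ.supp, l (d k) ≤ l (d' k) := by
    intro k hk
    by_cases h : d' k = d k
    · rw [h]
    · exact (key k hk _ (hdec.1 k hk).1 h).le
  have hlt := Finset.sum_lt_sum hle ⟨i, hi, key i hi _ (hdec.1 i hi).1 hne⟩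
  rw [← map_sum, ← map_sum, hsum, hdec.2] at hlt
  exact lt_irrefl _ hlt

/-- The components `v_i` (`i ∈ supp`) of the Minkowski decomposition of a vertex `v` of `M`. -/
noncomputable def part (v : W) : ℕ → W := Classical.epsilon (φ.IsDecomp v)

theorem part_spec {v : W} (hv : IsVertex φ.M v) : φ.IsDecomp v (φ.part v) :=
  Classical.epsilon_spec (Exists.imp (fun _ h => h.1) (φ.exists_decomp hv))

/-- The point `ρ_{i,j}^{(v)} = -(v_i - v_j) / (i - j)`. -/
noncomputable def rho (v : W) (i j : ℕ) : W :=
  -(((i : ℝ) - (j : ℝ))⁻¹ • (φ.part v i - φ.part v j))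

/-- Genericity: for every vertex `ν` of `M`, the points `ρ_{i,j}^{(ν)}` attached to different
unordered pairs `{i, j}` are different. -/
def IsGeneric : Prop :=
  ∀ ν, IsVertex φ.M ν → ∀ i ∈ φ.supp, ∀ j ∈ φ.supp, ∀ i' ∈ φ.supp, ∀ j' ∈ φ.supp,
    i ≠ j → i' ≠ j' → φ.rho ν i j = φ.rho ν i' j' → ({i, j} : Set ℕ) = {i', j'}

/-- The `i`-th summand `𝔔_i ⊙ G^{⊙ i}` of the evaluation at a vertex-cone collection. -/
def summand (G : ConeCollection W) (i : ℕ) : ConeCollection W :=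
  (ConeCollection.ofPolyhedron (φ.coeff i)).msum (G.mpow i)

/-- The evaluation `φ(G) = ⊕_{i ∈ supp} 𝔔_i ⊙ G^{⊙ i}`. -/
noncomputable def eval (G : ConeCollection W) : ConeCollection W :=
  ConeCollection.hullList ((φ.supp.sort (· ≤ ·)).map (φ.summand G))

/-- A VCC root: the support lies in every `N(Q_k)`, and every vertex of `φ(G)` is shared by two
distinct summands. -/
def IsRoot (G : ConeCollection W) : Prop :=
  G.IsVCC ∧ (∀ k ∈ φ.supp, G.support ⊆ innerNormal (φ.coeff k)) ∧
    ∀ w ∈ (φ.eval G).verts, ∃ i ∈ φ.supp, ∃ j ∈ φ.supp, i ≠ j ∧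
      w ∈ (φ.summand G i).verts ∧ w ∈ (φ.summand G j).verts

/-- A `v`-local root: one whose support lies in `N_M(v)`. -/
def IsLocalRoot (v : W) (G : ConeCollection W) : Prop :=
  φ.IsRoot G ∧ G.support ⊆ normalCone φ.M v

/-- A Minkowski–Weyl minimal `v`-local solution: a `v`-local root whose support is maximal among
the supports of all `v`-local roots with the same vertex set. -/
def IsMinkowskiWeylMinimal (v : W) (G : ConeCollection W) : Prop :=
  φ.IsLocalRoot v G ∧ ∀ G' : ConeCollection W, φ.IsLocalRoot v G' → G'.verts = G.verts →
    G.support ⊆ G'.support → G'.support = G.support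

/-- The non-zero vectors among `(v_k + k ρ_{i,j}) - (v_i + i ρ_{i,j})` and
`ρ_{i,j} - ρ_{i',j'}`: normal vectors of the non-degenerate hyperplanes `H^{(1,v)}_{i,j,k}` and
`H^{(2,v)}_{i,j,i',j'}` in `W*`. -/
def arrangementNormals (v : W) : Set W :=
  {x | x ≠ 0 ∧
    ((∃ i ∈ φ.supp, ∃ j ∈ φ.supp, ∃ k ∈ φ.supp, i ≠ j ∧
        x = (φ.part v k + (k : ℝ) • φ.rho v i j) - (φ.part v i + (i : ℝ) • φ.rho v i j)) ∨
     (∃ i ∈ φ.supp, ∃ j ∈ φ.supp, ∃ i' ∈ φ.supp, ∃ j' ∈ φ.supp, i ≠ j ∧ i' ≠ j' ∧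
        x = φ.rho v i j - φ.rho v i' j'))}

/-- The maximal cones of the fan `𝓕_v`, the restriction to `N_M(v)` of the central arrangement of
all non-degenerate hyperplanes. They are the closed regions: the region of a point `μ₀` in the
interior of `N_M(v)` and on no hyperplane consists of all points of `N_M(v)` that no hyperplane
strictly separates from `μ₀`. -/
def IsMaxCone (v : W) (C : Set (StrongDual ℝ W)) : Prop :=
  ∃ μ₀ ∈ interior (normalCone φ.M v), (∀ x ∈ φ.arrangementNormals v, μ₀ x ≠ 0) ∧
    C = {μ ∈ normalCone φ.M v | ∀ x ∈ φ.arrangementNormals v, 0 ≤ μ₀ x * μ x}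

/-- `p = (i, j)` is a primary label of `C`. -/
def IsPrimaryLabel (v : W) (C : Set (StrongDual ℝ W)) (p : ℕ × ℕ) : Prop :=
  ∀ k ∈ φ.supp, ∀ μ ∈ C,
    μ (φ.part v p.1 + (p.1 : ℝ) • φ.rho v p.1 p.2) ≤ μ (φ.part v k + (k : ℝ) • φ.rho v p.1 p.2)

/-- `(p, q) = (i, j, i', j')` is a secondary label of `C`. -/
def IsSecondaryLabel (v : W) (C : Set (StrongDual ℝ W)) (p q : ℕ × ℕ) : Prop :=
  ∀ μ ∈ C, μ (φ.rho v p.1 p.2) ≤ μ (φ.rho v q.1 q.2)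

/-- Local compatible systems `({C_1, …, C_t}, {(i_1, j_1), …, (i_t, j_t)})` at `v`. -/
structure LocalCompatibleSystem (v : W) where
  t : ℕ
  C : Fin t → Set (StrongDual ℝ W)
  I : Fin t → ℕ × ℕ
  C_injective : Function.Injective C
  isMaxCone : ∀ k, φ.IsMaxCone v (C k)
  fst_mem : ∀ k, (I k).1 ∈ φ.supp
  snd_mem : ∀ k, (I k).2 ∈ φ.supp
  fst_ne_snd : ∀ k, (I k).1 ≠ (I k).2
  /-- For each `k`, the union of the cones carrying the same point as `C k` is a convex
  polyhedral cone. -/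
  polyhedral : ∀ k, IsPolyhedralCone
    {μ | ∃ k', φ.rho v (I k').1 (I k').2 = φ.rho v (I k).1 (I k).2 ∧ μ ∈ C k'}
  primary : ∀ k, φ.IsPrimaryLabel v (C k) (I k)
  secondary : ∀ α β, α ≠ β → φ.IsSecondaryLabel v (C α) (I α) (I β)
  /-- If `f` is a facet of `C l` and of no other cone of the system, and `D` is a maximal cone
  outside the system with the facet `f`, then `D` lacks the primary label `I l` or one of the
  secondary labels `(I l, I β)`. -/
  boundary : ∀ (f : Set (StrongDual ℝ W)) (l : Fin t), IsFacet f (C l) →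
    (∀ k, IsFacet f (C k) → k = l) →
    ∀ D, φ.IsMaxCone v D → (∀ k, D ≠ C k) → IsFacet f D →
      ¬ φ.IsPrimaryLabel v D (I l) ∨ ∃ β, ¬ φ.IsSecondaryLabel v D (I l) (I β)

namespace LocalCompatibleSystem

variable {φ} {v : W} (L : φ.LocalCompatibleSystem v)

/-- The support `C_1 ∪ ⋯ ∪ C_t`. -/
def support : Set (StrongDual ℝ W) := ⋃ k, L.C k

/-- The associated vertex-cone collection `{(γ, C_γ)}`: its vertices are the points
`ρ_{i_k, j_k}`, and `C_γ` is the union of the `C_k` with `ρ_{i_k, j_k} = γ`. -/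
def vcc : ConeCollection W where
  verts := Set.range fun k => φ.rho v (L.I k).1 (L.I k).2
  cone γ := {μ | ∃ k, φ.rho v (L.I k).1 (L.I k).2 = γ ∧ μ ∈ L.C k}

end LocalCompatibleSystem

end PolyhedralPolynomial

end PolyRoot

/-!
Over `N_M(v)` the only vertex of `Q_i` that matters is the component `v_i` of `v`, so for a
vertex-cone collection `G` supported there the summand `𝔔_i ⊙ G^{⊙ i}` has the vertices
`v_i + i u`, with the cones of the vertices `u` of `G` (`summand_eq`). The convex hull of the
summands picks, at a functional `l` separating all these points, the one with the smallest value
(`eval_tiles`). Hence `G` is a root exactly when, for `l` generic in the cone of a vertex `u`, the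
minimum of `l (v_k + k u)` over `k` is attained by two exponents `i ≠ j` with
`v_i + i u = v_j + j u`, that is, `u = ρ_{i,j}`. Genericity of `φ` makes the pair `{i, j}` depend on
`u` only, and so local roots are the collections whose vertices are points `ρ_{i,j}` and whose cones
lie in the *cells* cut out of `N_M(v)` by the label inequalities (`isLocalRoot_iff`). The cells are
polyhedral, because the normal cone of a polyhedron at one of its points is
(`IsPolyhedron.isPolyhedralCone_normalCone`, by the dual form of Minkowski's theorem,
`exists_finite_test`). Therefore a local root is Minkowski–Weyl minimal if and only if its cones are
the full cells (`isMinkowskiWeylMinimal_iff`).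

It remains to compare cells with local compatible systems. A full-dimensional cell is the union of
the maximal cones of `𝓕_v` contained in it, as no inequality defining it changes its truth value
inside a maximal cone; the maximal cones contained in the cells of a minimal local root form a local
compatible system (`exists_localCompatibleSystem`), whose boundary condition holds because a maximal
cone with all the labels lies in a cell. Conversely, if the cones of a system with a common point
`γ` did not fill the cell of `γ`, a generic segment from their union to the rest of the cell would
leave the union through a single wall (`exists_crossing`). That wall is a facet of exactly one cone
of the system and of a maximal cone that is outside the system but inside the cell, contrary to the
boundary condition (`LocalCompatibleSystem.vcc_cone_eq`).
-/

namespace PolyRoot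

/-! ### Generic functionals and polyhedral cones -/

section Generic

variable {W : Type*} [NormedAddCommGroup W] [NormedSpace ℝ W]

theorem dense_apply_ne_zero {x : W} (hx : x ≠ 0) : Dense {l : StrongDual ℝ W | l x ≠ 0} := by
  let K : Submodule ℝ (StrongDual ℝ W) := LinearMap.ker (ContinuousLinearMap.apply ℝ ℝ x).toLinearMap
  have hK : {l : StrongDual ℝ W | l x ≠ 0} = (K : Set (StrongDual ℝ W))ᶜ := by
    ext l; simp [K]
  rw [hK, ← interior_eq_empty_iff_dense_compl]
  by_contra h
  have htop := K.eq_top_of_nonempty_interior' (Set.nonempty_iff_ne_empty.2 h)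
  obtain ⟨l, -, hl⟩ := exists_dual_vector ℝ x (norm_ne_zero_iff.2 hx)
  have : l ∈ K := htop ▸ Submodule.mem_top
  have h0 : l x = 0 := by simpa [K] using this
  rw [h0] at hl
  exact hx (by simpa using hl.symm)

/-- The functionals separating the points of a finite set are dense. -/
theorem dense_injOn {A : Set W} (hA : A.Finite) : Dense {l : StrongDual ℝ W | Set.InjOn l A} := by
  have hF : ((fun q : W × W => q.1 - q.2) '' A ×ˢ A).Finite := (hA.prod hA).image _
  have key : ∀ F : Set W, F.Finite →
      IsOpen {l : StrongDual ℝ W | ∀ x ∈ F, x ≠ 0 → l x ≠ 0} ∧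
        Dense {l : StrongDual ℝ W | ∀ x ∈ F, x ≠ 0 → l x ≠ 0} := by
    intro F hF
    induction F, hF using Set.Finite.induction_on with
    | empty => simp
    | @insert a s _ _ ih =>
      have hs : {l : StrongDual ℝ W | ∀ x ∈ insert a s, x ≠ 0 → l x ≠ 0} =
          {l | a ≠ 0 → l a ≠ 0} ∩ {l | ∀ x ∈ s, x ≠ 0 → l x ≠ 0} := by
        ext l; simp
      rw [hs]
      by_cases ha : a = 0
      · simpa [ha] using ih
      · have ho : IsOpen {l : StrongDual ℝ W | l a ≠ 0} :=
          isOpen_ne_fun (ContinuousLinearMap.apply ℝ ℝ a).continuous continuous_const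
        simp only [ne_eq, ha, not_false_eq_true, forall_const] at ho ⊢
        exact ⟨ho.inter ih.1, (dense_apply_ne_zero ha).inter_of_isOpen_left ih.2 ho⟩
  refine (key _ hF).2.mono fun l hl a ha b hb hab => ?_
  by_contra hne
  exact hl (a - b) ⟨(a, b), ⟨ha, hb⟩, rfl⟩ (sub_ne_zero.2 hne) (by simp [hab])

theorem FullDim.exists_injOn {U : Set (StrongDual ℝ W)} (hU : FullDim U) {A : Set W}
    (hA : A.Finite) : ∃ l ∈ interior U, Set.InjOn l A := by
  obtain ⟨l, h1, h2⟩ := (dense_injOn hA).inter_open_nonempty _ isOpen_interior hU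
  exact ⟨l, h1, h2⟩

theorem FullDim.mono {U V : Set (StrongDual ℝ W)} (hU : FullDim U) (h : U ⊆ V) : FullDim V :=
  Set.Nonempty.mono (interior_mono h) hU

/-- A closed set containing the generic interior points of a regular set contains that set. -/
theorem subset_of_generic {U S : Set (StrongDual ℝ W)} (hU : U ⊆ closure (interior U))
    (hS : IsClosed S) {A : Set W} (hA : A.Finite)
    (h : ∀ l ∈ interior U, Set.InjOn l A → l ∈ S) : U ⊆ S := by
  refine hU.trans (closure_minimal ?_ hS)
  refine ((dense_injOn hA).open_subset_closure_inter isOpen_interior).trans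
    (closure_minimal ?_ hS)
  exact fun l hl => h l hl.1 hl.2

theorem eq_of_fullDim {U : Set (StrongDual ℝ W)} (hU : FullDim U) {a b : W}
    (h : ∀ l ∈ U, l a = l b) : a = b := by
  obtain ⟨l, hl, hi⟩ := hU.exists_injOn (A := {a, b}) (by simp)
  exact hi (by simp) (by simp) (h l (interior_subset hl))

theorem isClosed_setOf_apply_le (a b : W) : IsClosed {l : StrongDual ℝ W | l a ≤ l b} :=
  isClosed_le (ContinuousLinearMap.apply ℝ ℝ a).continuous
    (ContinuousLinearMap.apply ℝ ℝ b).continuous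

theorem isOpen_setOf_apply_lt (a b : W) : IsOpen {l : StrongDual ℝ W | l a < l b} :=
  isOpen_lt (ContinuousLinearMap.apply ℝ ℝ a).continuous
    (ContinuousLinearMap.apply ℝ ℝ b).continuous

theorem isClosed_normalCone (P : Set W) (p : W) : IsClosed (normalCone P p) := by
  have : normalCone P p = ⋂ x ∈ P, {l | l p ≤ l x} := by ext l; simp [normalCone]
  rw [this]
  exact isClosed_biInter fun x _ => isClosed_setOf_apply_le p x

theorem IsPolyhedralCone.isClosed {C : Set (StrongDual ℝ W)} (h : IsPolyhedralCone C) :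
    IsClosed C := by
  obtain ⟨S, -, rfl⟩ := h
  have : {l : StrongDual ℝ W | ∀ x ∈ S, 0 ≤ l x} = ⋂ x ∈ S, {l | l 0 ≤ l x} := by
    ext l; simp
  rw [this]
  exact isClosed_biInter fun x _ => isClosed_setOf_apply_le 0 x

theorem IsPolyhedralCone.convex {C : Set (StrongDual ℝ W)} (h : IsPolyhedralCone C) :
    Convex ℝ C := by
  obtain ⟨S, -, rfl⟩ := h
  intro l hl m hm a b ha hb _ x hx
  have := mul_nonneg ha (hl x hx)
  have := mul_nonneg hb (hm x hx)
  simp only [add_apply, smul_apply, smul_eq_mul]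
  linarith

theorem IsPolyhedralCone.inter {C D : Set (StrongDual ℝ W)} (hC : IsPolyhedralCone C)
    (hD : IsPolyhedralCone D) : IsPolyhedralCone (C ∩ D) := by
  obtain ⟨S, hS, rfl⟩ := hC
  obtain ⟨T, hT, rfl⟩ := hD
  refine ⟨S ∪ T, hS.union hT, ?_⟩
  ext l
  simp only [Set.mem_inter_iff, Set.mem_ofPred_eq, Set.mem_union]
  exact ⟨fun h x hx => hx.elim (h.1 x) (h.2 x), fun h => ⟨fun x hx => h x (.inl hx),
    fun x hx => h x (.inr hx)⟩⟩

theorem isPolyhedralCone_biInter {ι : Type*} (s : Finset ι) (C : ι → Set (StrongDual ℝ W))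
    (h : ∀ i ∈ s, IsPolyhedralCone (C i)) : IsPolyhedralCone {l | ∀ i ∈ s, l ∈ C i} := by
  classical
  induction s using Finset.induction_on with
  | empty => exact ⟨∅, Set.finite_empty, by simp⟩
  | insert a s _ ih =>
    have := (h a (by simp)).inter (ih fun i hi => h i (by simp [hi]))
    convert this using 1
    ext l; simp

theorem isPolyhedralCone_apply_le (a b : W) :
    IsPolyhedralCone {l : StrongDual ℝ W | l a ≤ l b} :=
  ⟨{b - a}, Set.finite_singleton _, by ext l; simp⟩

theorem subset_closure_interior {C : Set (StrongDual ℝ W)} (hC : Convex ℝ C) (h : FullDim C) :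
    C ⊆ closure (interior C) := by
  rw [hC.closure_interior_eq_closure_of_nonempty_interior h]
  exact subset_closure

end Generic

section NormalCone

variable {W : Type*} [NormedAddCommGroup W] [NormedSpace ℝ W]

/-- A polyhedral cone `{y | 0 ≤ a k y}` contains finitely many points that test whether a
functional is nonnegative on it. This is the dual form of Minkowski's theorem that the cone is
finitely generated. -/
theorem exists_finite_test [FiniteDimensional ℝ W] {ι : Type*} (s : Finset ι)
    (a : ι → StrongDual ℝ W) :
    ∃ S : Set W, S.Finite ∧ (∀ y ∈ S, ∀ k ∈ s, 0 ≤ a k y) ∧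
      ∀ l : StrongDual ℝ W, (∀ y ∈ S, 0 ≤ l y) → ∀ y, (∀ k ∈ s, 0 ≤ a k y) → 0 ≤ l y := by
  classical
  induction s using Finset.induction_on with
  | empty =>
    let b := Module.finBasis ℝ W
    refine ⟨Set.range b ∪ Set.range (fun i => -b i),
      (Set.finite_range _).union (Set.finite_range _), by simp, fun l hl y _ => ?_⟩
    have h0 : ∀ i, l (b i) = 0 := fun i => by
      have h1 := hl (b i) (.inl ⟨i, rfl⟩)
      have h2 := hl (-b i) (.inr ⟨i, rfl⟩)
      rw [map_neg] at h2
      linarith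
    have : l.toLinearMap = 0 := b.ext fun i => by simpa using h0 i
    have : l y = 0 := by simpa using congrArg (fun f => f y) this
    exact this.ge
  | insert k₀ s _ ih =>
    obtain ⟨S, hS, hST, hdual⟩ := ih
    set α := a k₀
    refine ⟨{y ∈ S | 0 ≤ α y} ∪
      (fun q : W × W => α q.1 • q.2 - α q.2 • q.1) '' ({y ∈ S | 0 < α y} ×ˢ {y ∈ S | α y < 0}),
      ?_, ?_, ?_⟩
    · exact (hS.sep _).union (((hS.sep _).prod (hS.sep _)).image _)
    · rintro y (⟨hy, hα⟩ | ⟨⟨y, z⟩, ⟨⟨hy, hyα⟩, ⟨hz, hzα⟩⟩, rfl⟩) k hk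
      · rcases Finset.mem_insert.1 hk with rfl | hk
        · exact hα
        · exact hST y hy k hk
      · rcases Finset.mem_insert.1 hk with rfl | hk
        · simp only [map_sub, map_smul, smul_eq_mul]
          exact (sub_eq_zero.2 (mul_comm _ _)).ge
        · simp only [map_sub, map_smul, smul_eq_mul]
          dsimp at hyα hzα
          nlinarith [hST y hy k hk, hST z hz k hk,
            mul_nonneg hyα.le (hST z hz k hk), mul_nonneg (neg_nonneg.2 hzα.le) (hST y hy k hk)]
    · intro l hl y hy
      -- The functional `l - c • α` is nonnegative on `S` for a suitable `c ≥ 0`.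
      obtain ⟨c, hc0, hc⟩ : ∃ c : ℝ, 0 ≤ c ∧ ∀ z ∈ S, c * α z ≤ l z := by
        have hfin := (((hS.sep fun z => α z < 0).image fun z => l z / α z).insert 0)
        obtain ⟨c, hcm, hcmax⟩ := hfin.exists_maximal ⟨0, by simp⟩
        have hcmax' : ∀ x ∈ insert 0 ((fun z => l z / α z) '' {z ∈ S | α z < 0}), x ≤ c :=
          fun x hx => (le_total x c).elim id fun h => hcmax hx h
        refine ⟨c, hcmax' 0 (by simp), fun z hz => ?_⟩
        rcases lt_trichotomy (α z) 0 with h | h | h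
        · have := hcmax' (l z / α z) (.inr ⟨z, ⟨hz, h⟩, rfl⟩)
          rwa [div_le_iff_of_neg h] at this
        · rw [h, mul_zero]
          exact hl z (.inl ⟨hz, h.ge⟩)
        · rcases hcm with rfl | ⟨t, ⟨ht, htα⟩, rfl⟩
          · rw [zero_mul]
            exact hl z (.inl ⟨hz, h.le⟩)
          · have := hl _ (.inr ⟨(z, t), ⟨⟨hz, h⟩, ⟨ht, htα⟩⟩, rfl⟩)
            simp only [map_sub, map_smul, smul_eq_mul] at this
            dsimp at htα ⊢
            rw [div_mul_eq_mul_div, div_le_iff_of_neg htα]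
            linarith
      have h1 := hdual (l - c • α) (fun z hz => by simpa using hc z hz) y
        fun k hk => hy k (Finset.mem_insert_of_mem hk)
      have h2 := mul_nonneg hc0 (hy k₀ (Finset.mem_insert_self _ _))
      simp only [sub_apply, smul_apply, smul_eq_mul] at h1
      linarith

theorem IsPolyhedron.isPolyhedralCone_normalCone [FiniteDimensional ℝ W] {P : Set W}
    (hP : IsPolyhedron P) {p : W} (hp : p ∈ P) : IsPolyhedralCone (normalCone P p) := by
  classical
  obtain ⟨m, a, b, rfl⟩ := hP
  -- The constraints active at `p` describe the tangent cone, whose dual is the normal cone.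
  obtain ⟨S, hS, hST, hdual⟩ := exists_finite_test (Finset.univ.filter fun k => a k p = b k) a
  refine ⟨S, hS, ?_⟩
  ext l
  constructor
  · intro hl y hy
    have hev : ∀ᶠ ε : ℝ in nhdsWithin 0 (Set.Ioi 0), ∀ k, b k ≤ a k (p + ε • y) := by
      refine Filter.eventually_all.2 fun k => ?_
      by_cases hk : a k p = b k
      · filter_upwards [self_mem_nhdsWithin] with ε hε
        have := mul_nonneg (le_of_lt hε) (hST y hy k (by simpa using hk))
        simp only [map_add, map_smul, smul_eq_mul]
        linarith
      · have hlt : b k < a k (p + (0 : ℝ) • y) := by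
          simpa using lt_of_le_of_ne (hp k) (Ne.symm hk)
        have hc : Continuous fun ε : ℝ => a k (p + ε • y) := by fun_prop
        filter_upwards [nhdsWithin_le_nhds (hc.continuousAt.eventually (lt_mem_nhds hlt))]
          with ε hε using hε.le
    obtain ⟨ε, hε, hε0⟩ := (hev.and self_mem_nhdsWithin).exists
    have := hl _ hε
    simp only [map_add, map_smul, smul_eq_mul] at this
    exact nonneg_of_mul_nonneg_right (by linarith) hε0
  · intro hl x hx
    have := hdual l hl (x - p) fun k hk => by
      have hk : a k p = b k := by simpa using hk
      rw [map_sub, hk]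
      linarith [hx k]
    rw [map_sub] at this
    linarith

end NormalCone

namespace PolyhedralPolynomial

variable {W : Type*} [NormedAddCommGroup W] [NormedSpace ℝ W] (φ : PolyhedralPolynomial W)
  {v : W}

/-- The normal cone of a Minkowski sum is the intersection of the normal cones of the
corresponding points of the summands. -/
theorem mem_normalCone_M (hv : IsVertex φ.M v) {l : StrongDual ℝ W} :
    l ∈ normalCone φ.M v ↔ ∀ i ∈ φ.supp, l ∈ normalCone (φ.coeff i) (φ.part v i) := by
  classical
  obtain ⟨hd, hsum⟩ := φ.part_spec hv
  constructor
  · intro hl i hi x hx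
    have hs : ∑ k ∈ φ.supp, Function.update (φ.part v) i x k = v - φ.part v i + x := by
      have h := Finset.sum_sdiff (f := φ.part v) (Finset.singleton_subset_iff.2 hi)
      rw [hsum, Finset.sum_singleton] at h
      rw [Finset.sum_update_of_mem hi, eq_sub_of_add_eq h, add_comm]
    have hmem : v - φ.part v i + x ∈ φ.M := by
      refine (Set.mem_finsetSum _ _ _).2 ⟨Function.update (φ.part v) i x, ?_, hs⟩
      intro k hk
      by_cases h : k = i
      · subst h; simpa using hx
      · simpa [h] using (hd k hk).1
    have := hl _ hmem
    simp only [map_add, map_sub] at this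
    linarith
  · intro hl x hx
    obtain ⟨d, hdm, rfl⟩ := (Set.mem_finsetSum _ _ _).1 hx
    rw [← hsum, map_sum, map_sum]
    exact Finset.sum_le_sum fun i hi => hl i hi _ (hdm hi)

theorem isPolyhedralCone_normalCone_M [FiniteDimensional ℝ W] (hv : IsVertex φ.M v) :
    IsPolyhedralCone (normalCone φ.M v) := by
  have h := isPolyhedralCone_biInter φ.supp (fun i => normalCone (φ.coeff i) (φ.part v i))
    fun i hi => (φ.isPolyhedron i hi).isPolyhedralCone_normalCone ((φ.part_spec hv).1 i hi).1
  convert h using 1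
  ext l
  exact φ.mem_normalCone_M hv

end PolyhedralPolynomial

/-! ### Hulls and Minkowski powers of tiling collections -/

namespace ConeCollection

variable {W : Type*} [NormedAddCommGroup W] [NormedSpace ℝ W]

/-- The part of the definition of a vertex-cone collection that survives without convexity:
closed cones with interior that tile the set `T`, each vertex minimising on its cone. -/
structure Tiles (T : Set (StrongDual ℝ W)) (G : ConeCollection W) : Prop where
  finite : G.verts.Finite
  isClosed : ∀ u ∈ G.verts, IsClosed (G.cone u)
  fullDim : ∀ u ∈ G.verts, FullDim (G.cone u)
  le : ∀ u ∈ G.verts, ∀ u' ∈ G.verts, ∀ l ∈ G.cone u, l u ≤ l u'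
  support_eq : G.support = T

variable {T : Set (StrongDual ℝ W)} {G G₁ G₂ : ConeCollection W}

theorem IsVCC.le' (hG : G.IsVCC) : ∀ u ∈ G.verts, ∀ u' ∈ G.verts, ∀ l ∈ G.cone u, l u ≤ l u' := by
  intro u hu u' hu' l hl
  by_cases h : u = u'
  · rw [h]
  · exact hG.le u hu u' hu' h l hl

theorem IsVCC.subset_closure_interior (hG : G.IsVCC) {u : W} (hu : u ∈ G.verts) :
    G.cone u ⊆ closure (interior (G.cone u)) :=
  PolyRoot.subset_closure_interior (hG.polyhedral u hu).convex (hG.fullDim u hu)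

theorem cone_subset_support {u : W} (hu : u ∈ G.verts) : G.cone u ⊆ G.support :=
  fun _ hl => ⟨u, hu, hl⟩

theorem IsVCC.support_subset_closure (hG : G.IsVCC) :
    G.support ⊆ closure (interior G.support) := by
  rintro l ⟨u, hu, hl⟩
  exact closure_mono (interior_mono (cone_subset_support hu)) (hG.subset_closure_interior hu hl)

theorem Tiles.cone_subset (h : G.Tiles T) {u : W} (hu : u ∈ G.verts) : G.cone u ⊆ T :=
  h.support_eq ▸ cone_subset_support hu

/-- At a functional separating the vertices, the cone containing it contains it in its interior. -/
theorem Tiles.mem_interior (h : G.Tiles T) {l : StrongDual ℝ W} (hl : l ∈ interior T)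
    (hinj : Set.InjOn l G.verts) {u : W} (hu : u ∈ G.verts) (hlu : l ∈ G.cone u) :
    l ∈ interior (G.cone u) := by
  -- A neighbourhood of `l` misses the finitely many other cones, so it lies in the cone of `u`.
  have hfin : (G.verts \ {u}).Finite := h.finite.sdiff
  have hC : IsClosed (⋃ u' ∈ G.verts \ {u}, G.cone u') :=
    hfin.isClosed_biUnion fun u' hu' => h.isClosed u' hu'.1
  have hlC : l ∉ ⋃ u' ∈ G.verts \ {u}, G.cone u' := by
    simp only [Set.mem_iUnion, not_exists]
    intro u' hu' hlu'
    exact hu'.2 (hinj hu'.1 hu (le_antisymm (h.le u' hu'.1 u hu l hlu') (h.le u hu u' hu'.1 l hlu)))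
  refine _root_.mem_interior.2 ⟨interior T ∩ (⋃ u' ∈ G.verts \ {u}, G.cone u')ᶜ, ?_,
    isOpen_interior.inter hC.isOpen_compl, hl, hlC⟩
  rintro m ⟨hm, hmC⟩
  obtain ⟨u', hu', hmu'⟩ := h.support_eq.symm ▸ interior_subset hm
  by_cases he : u' = u
  · exact he ▸ hmu'
  · exact absurd (Set.mem_biUnion (show u' ∈ G.verts \ {u} from ⟨hu', he⟩) hmu') hmC

theorem hull_comm : hull G₁ G₂ = hull G₂ G₁ := by
  unfold hull
  congr 1
  · ext w
    simp only [Set.mem_ofPred_eq]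
    rw [Set.inter_comm (G₁.cone w)]
    by_cases h₁ : w ∈ G₁.verts <;> by_cases h₂ : w ∈ G₂.verts <;> simp [h₁, h₂]
  · funext w
    ext l
    simp only [Set.mem_ofPred_eq]
    tauto

theorem hull_verts_subset : (hull G₁ G₂).verts ⊆ G₁.verts ∪ G₂.verts := by
  rintro w (⟨h, -⟩ | ⟨h, -⟩ | ⟨h, -⟩)
  exacts [.inl h, .inl h, .inr h]

theorem Tiles.hull_le (h₁ : G₁.Tiles T) (h₂ : G₂.Tiles T) {w u : W} (hu : u ∈ G₁.verts ∪ G₂.verts)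
    {l : StrongDual ℝ W} (hl : l ∈ (hull G₁ G₂).cone w) : l w ≤ l u := by
  rcases hl with ⟨hw₁, hw₂, hl₁, hl₂⟩ | ⟨hw, -, hl, hle⟩ | ⟨hw, -, hl, hle⟩ <;>
    rcases hu with hu | hu
  exacts [h₁.le w hw₁ u hu l hl₁, h₂.le w hw₂ u hu l hl₂, h₁.le w hw u hu l hl, hle u hu, hle u hu,
    h₂.le w hw u hu l hl]

/-- A functional in the interior of two cones, whose vertices are related by `≤`, lies in the cone
of the smaller vertex in the hull. -/
theorem Tiles.mem_hull_support (h₂ : G₂.Tiles T) {l : StrongDual ℝ W} {u₁ u₂ : W}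
    (hu₁ : u₁ ∈ G₁.verts) (hu₂ : u₂ ∈ G₂.verts) (hl₁ : l ∈ interior (G₁.cone u₁))
    (hl₂ : l ∈ interior (G₂.cone u₂)) (hle : l u₁ ≤ l u₂) (hinj : l u₁ = l u₂ → u₁ = u₂) :
    l ∈ (hull G₁ G₂).support := by
  by_cases he : u₁ = u₂
  · subst he
    refine ⟨u₁, .inl ⟨hu₁, hu₂, l, ?_⟩, .inl ⟨hu₁, hu₂, interior_subset hl₁, interior_subset hl₂⟩⟩
    rw [interior_inter]
    exact ⟨hl₁, hl₂⟩
  · have hlt : l u₁ < l u₂ := lt_of_le_of_ne hle fun h => he (hinj h)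
    have hmin : ∀ u ∈ G₂.verts, l u₁ < l u :=
      fun u hu => hlt.trans_le (h₂.le u₂ hu₂ u hu l (interior_subset hl₂))
    have hnot : u₁ ∉ G₂.verts := fun h => lt_irrefl _ (hmin u₁ h)
    exact ⟨u₁, .inr (.inl ⟨hu₁, hnot, l, hl₁, hmin⟩),
      .inr (.inl ⟨hu₁, hnot, interior_subset hl₁, fun u hu => (hmin u hu).le⟩)⟩

theorem Tiles.hull_isClosed (h₁ : G₁.Tiles T) (h₂ : G₂.Tiles T) {w : W} :
    IsClosed ((hull G₁ G₂).cone w) := by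
  have hcl : ∀ G : ConeCollection W, IsClosed {l : StrongDual ℝ W | ∀ u ∈ G.verts, l w ≤ l u} := by
    intro G
    have : {l : StrongDual ℝ W | ∀ u ∈ G.verts, l w ≤ l u} = ⋂ u ∈ G.verts, {l | l w ≤ l u} := by
      ext; simp
    rw [this]
    exact isClosed_biInter fun u _ => isClosed_setOf_apply_le w u
  by_cases hw₁ : w ∈ G₁.verts <;> by_cases hw₂ : w ∈ G₂.verts
  · have : (hull G₁ G₂).cone w = G₁.cone w ∩ G₂.cone w := by ext; simp [hull, hw₁, hw₂]
    rw [this]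
    exact (h₁.isClosed w hw₁).inter (h₂.isClosed w hw₂)
  · have : (hull G₁ G₂).cone w = G₁.cone w ∩ {l | ∀ u ∈ G₂.verts, l w ≤ l u} := by
      ext; simp [hull, hw₁, hw₂]
    rw [this]
    exact (h₁.isClosed w hw₁).inter (hcl G₂)
  · have : (hull G₁ G₂).cone w = G₂.cone w ∩ {l | ∀ u ∈ G₁.verts, l w ≤ l u} := by
      ext; simp [hull, hw₁, hw₂]
    rw [this]
    exact (h₂.isClosed w hw₂).inter (hcl G₁)
  · have : (hull G₁ G₂).cone w = ∅ := by ext; simp [hull, hw₁, hw₂]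
    rw [this]
    exact isClosed_empty

theorem fullDim_of_interior_lt {C : Set (StrongDual ℝ W)} {w : W} {A : Set W} (hA : A.Finite)
    {l : StrongDual ℝ W} (hl : l ∈ interior C) (hlt : ∀ u ∈ A, l w < l u) :
    FullDim (C ∩ {l | ∀ u ∈ A, l w ≤ l u}) := by
  refine ⟨l, mem_interior.2 ⟨interior C ∩ ⋂ u ∈ A, {l | l w < l u}, ?_,
    isOpen_interior.inter (hA.isOpen_biInter fun u _ => isOpen_setOf_apply_lt w u), hl,
    Set.mem_iInter₂.2 hlt⟩⟩
  rintro m ⟨hm, hm'⟩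
  exact ⟨interior_subset hm, fun u hu => le_of_lt (Set.mem_iInter₂.1 hm' u hu)⟩

theorem Tiles.hull (hT : T ⊆ closure (interior T)) (h₁ : G₁.Tiles T) (h₂ : G₂.Tiles T) :
    (hull G₁ G₂).Tiles T := by
  have hfin : (ConeCollection.hull G₁ G₂).verts.Finite :=
    (h₁.finite.union h₂.finite).subset hull_verts_subset
  refine ⟨hfin, fun w _ => h₁.hull_isClosed h₂, ?_,
    fun w _ u hu l hl => h₁.hull_le h₂ (hull_verts_subset hu) hl, Set.Subset.antisymm ?_ ?_⟩
  · rintro w (⟨hw₁, hw₂, hf⟩ | ⟨hw₁, hw₂, l, hl, hlt⟩ | ⟨hw₂, hw₁, l, hl, hlt⟩)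
    · exact hf.mono fun l hl => .inl ⟨hw₁, hw₂, hl.1, hl.2⟩
    · exact (fullDim_of_interior_lt h₂.finite hl hlt).mono
        fun l hl => .inr (.inl ⟨hw₁, hw₂, hl.1, hl.2⟩)
    · exact (fullDim_of_interior_lt h₁.finite hl hlt).mono
        fun l hl => .inr (.inr ⟨hw₂, hw₁, hl.1, hl.2⟩)
  · rintro l ⟨w, -, ⟨hw, -, hl, -⟩ | ⟨hw, -, hl, -⟩ | ⟨hw, -, hl, -⟩⟩
    exacts [h₁.cone_subset hw hl, h₁.cone_subset hw hl, h₂.cone_subset hw hl]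
  · refine subset_of_generic hT (hfin.isClosed_biUnion (f := (ConeCollection.hull G₁ G₂).cone)
      (fun w _ => h₁.hull_isClosed h₂) |> fun h => ?_) (h₁.finite.union h₂.finite) ?_
    · convert h using 1
      ext l; simp [support]
    · intro l hl hinj
      have hlT := interior_subset hl
      obtain ⟨u₁, hu₁, hl₁⟩ := h₁.support_eq.symm ▸ hlT
      obtain ⟨u₂, hu₂, hl₂⟩ := h₂.support_eq.symm ▸ hlT
      have hi₁ := h₁.mem_interior hl (hinj.mono Set.subset_union_left) hu₁ hl₁
      have hi₂ := h₂.mem_interior hl (hinj.mono Set.subset_union_right) hu₂ hl₂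
      rcases le_total (l u₁) (l u₂) with hle | hle
      · exact h₂.mem_hull_support hu₁ hu₂ hi₁ hi₂ hle fun h => hinj (.inl hu₁) (.inr hu₂) h
      · rw [hull_comm]
        exact h₁.mem_hull_support hu₂ hu₁ hi₂ hi₁ hle fun h => hinj (.inr hu₂) (.inl hu₁) h

/-- On the cone of a vertex of an iterated hull, that vertex minimises over the vertices of all
the members of the list. -/
theorem Tiles.hullList (hT : T ⊆ closure (interior T)) :
    ∀ Gs : List (ConeCollection W), Gs ≠ [] → (∀ G ∈ Gs, G.Tiles T) →
      (hullList Gs).Tiles T ∧ ∀ w ∈ (hullList Gs).verts, (∃ G ∈ Gs, w ∈ G.verts) ∧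
        ∀ l ∈ (hullList Gs).cone w, ∀ G ∈ Gs, ∀ u ∈ G.verts, l w ≤ l u
  | [], h, _ => absurd rfl h
  | [G], _, h => by
    have hG := h G (by simp)
    exact ⟨hG, fun w hw => ⟨⟨G, by simp, hw⟩, fun l hl G' hG' u hu => by
      rw [List.mem_singleton] at hG'
      subst hG'
      exact hG.le w hw u hu l hl⟩⟩
  | G :: G' :: Gs, _, h => by
    obtain ⟨ih, ihm⟩ := Tiles.hullList hT (G' :: Gs) (by simp) fun H hH => h H (by simp [hH])
    have hG := h G (by simp)
    have hH := hG.hull hT ih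
    refine ⟨hH, fun w hw => ⟨?_, fun l hl H hHm u hu => ?_⟩⟩
    · rcases hull_verts_subset hw with hw | hw
      · exact ⟨G, by simp, hw⟩
      · obtain ⟨H, hH, hw⟩ := (ihm w hw).1
        exact ⟨H, List.mem_cons_of_mem _ hH, hw⟩
    · rcases List.mem_cons.1 hHm with rfl | hHm
      · exact hG.hull_le ih (.inl hu) hl
      · -- `l` lies in the cone of some vertex `w'` of the hull of the tail.
        have hlT : l ∈ T := hH.cone_subset hw hl
        obtain ⟨w', hw', hlw'⟩ := ih.support_eq.symm ▸ hlT
        exact (hG.hull_le ih (.inr hw') hl).trans ((ihm w' hw').2 l hlw' H hHm u hu)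

theorem IsVCC.eq_of_fullDim_inter (hG : G.IsVCC) {u u' : W} (hu : u ∈ G.verts)
    (hu' : u' ∈ G.verts) (h : FullDim (G.cone u ∩ G.cone u')) : u = u' :=
  eq_of_fullDim h fun l hl => le_antisymm (hG.le' u hu u' hu' l hl.1) (hG.le' u' hu' u hu l hl.2)

/-- The `k`-th Minkowski power dilates the vertices by `k` and keeps the cones. -/
theorem IsVCC.mpow_succ (hG : G.IsVCC) (k : ℕ) :
    (G.mpow (k + 1)).verts = (fun u => ((k + 1 : ℕ) : ℝ) • u) '' G.verts ∧
      ∀ u ∈ G.verts, (G.mpow (k + 1)).cone (((k + 1 : ℕ) : ℝ) • u) = G.cone u := by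
  induction k with
  | zero => simp [mpow]
  | succ k ih =>
    obtain ⟨ihv, ihc⟩ := ih
    have hsm : ∀ u : W, ((k + 1 + 1 : ℕ) : ℝ) • u = ((k + 1 : ℕ) : ℝ) • u + u := fun u => by
      rw [Nat.cast_succ (k + 1), add_smul, one_smul]
    have key : ∀ v₁ ∈ (G.mpow (k + 1)).verts, ∀ v₂ ∈ G.verts,
        FullDim ((G.mpow (k + 1)).cone v₁ ∩ G.cone v₂) → v₁ = ((k + 1 : ℕ) : ℝ) • v₂ := by
      intro v₁ hv₁ v₂ hv₂ hf
      rw [ihv] at hv₁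
      obtain ⟨u, hu, rfl⟩ := hv₁
      dsimp only at hf ⊢
      rw [ihc u hu] at hf
      rw [hG.eq_of_fullDim_inter hu hv₂ hf]
    have hmem : ∀ u ∈ G.verts, ((k + 1 : ℕ) : ℝ) • u ∈ (G.mpow (k + 1)).verts :=
      fun u hu => by rw [ihv]; exact ⟨u, hu, rfl⟩
    have hfull : ∀ u ∈ G.verts,
        FullDim ((G.mpow (k + 1)).cone (((k + 1 : ℕ) : ℝ) • u) ∩ G.cone u) := fun u hu => by
      rw [ihc u hu, Set.inter_self]
      exact hG.fullDim u hu
    constructor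
    · ext w
      constructor
      · rintro ⟨v₁, hv₁, v₂, hv₂, hf, rfl⟩
        exact ⟨v₂, hv₂, by dsimp only; rw [key v₁ hv₁ v₂ hv₂ hf, hsm]⟩
      · rintro ⟨u, hu, rfl⟩
        exact ⟨_, hmem u hu, u, hu, hfull u hu, hsm u⟩
    · intro u hu
      ext l
      constructor
      · rintro ⟨v₁, hv₁, v₂, hv₂, hf, he, -, hl⟩
        rw [key v₁ hv₁ v₂ hv₂ hf, ← hsm] at he
        rwa [smul_right_injective W (by positivity : ((k + 1 + 1 : ℕ) : ℝ) ≠ 0) he]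
      · intro hl
        exact ⟨_, hmem u hu, u, hu, hfull u hu, hsm u, by rwa [ihc u hu], hl⟩

end ConeCollection

namespace PolyhedralPolynomial

open ConeCollection

variable {W : Type*} [NormedAddCommGroup W] [NormedSpace ℝ W] (φ : PolyhedralPolynomial W)
  {v : W} {G : ConeCollection W}

/-- Over `N_M(v)` only the vertex `v_i` of `Q_i` contributes to `𝔔_i ⊙ G^{⊙ i}`. -/
theorem summand_eq (hv : IsVertex φ.M v) (hG : G.IsVCC) (hs : G.support ⊆ normalCone φ.M v)
    {i : ℕ} (hi : i ∈ φ.supp) (hi0 : i ≠ 0) :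
    (φ.summand G i).verts = (fun u => φ.part v i + (i : ℝ) • u) '' G.verts ∧
      ∀ u ∈ G.verts, (φ.summand G i).cone (φ.part v i + (i : ℝ) • u) = G.cone u := by
  obtain ⟨k, rfl⟩ := Nat.exists_eq_succ_of_ne_zero hi0
  obtain ⟨hpv, hpc⟩ := hG.mpow_succ k
  have hvi := (φ.part_spec hv).1 _ hi
  have hsub : ∀ u ∈ G.verts, G.cone u ⊆ normalCone (φ.coeff (k + 1)) (φ.part v (k + 1)) :=
    fun u hu l hl => (φ.mem_normalCone_M hv).1 (hs ⟨u, hu, hl⟩) _ hi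
  have key : ∀ q, IsVertex (φ.coeff (k + 1)) q → ∀ u ∈ G.verts,
      FullDim (normalCone (φ.coeff (k + 1)) q ∩ G.cone u) → q = φ.part v (k + 1) :=
    fun q hq u hu hf => eq_of_fullDim hf fun l hl =>
      le_antisymm (hl.1 _ hvi.1) (hsub u hu hl.2 _ hq.1)
  have hfull : ∀ u ∈ G.verts, FullDim (normalCone (φ.coeff (k + 1)) (φ.part v (k + 1)) ∩
      (G.mpow (k + 1)).cone (((k + 1 : ℕ) : ℝ) • u)) := fun u hu => by
    rw [hpc u hu, Set.inter_eq_right.2 (hsub u hu)]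
    exact hG.fullDim u hu
  have hmem : ∀ u ∈ G.verts, ((k + 1 : ℕ) : ℝ) • u ∈ (G.mpow (k + 1)).verts :=
    fun u hu => by rw [hpv]; exact ⟨u, hu, rfl⟩
  constructor
  · ext w
    constructor
    · rintro ⟨q, hq, u', hu', hf, rfl⟩
      rw [hpv] at hu'
      obtain ⟨u, hu, rfl⟩ := hu'
      dsimp only at hf ⊢
      rw [hpc u hu] at hf
      exact ⟨u, hu, by dsimp only; rw [key q hq u hu hf]⟩
    · rintro ⟨u, hu, rfl⟩
      exact ⟨_, hvi, _, hmem u hu, hfull u hu, rfl⟩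
  · intro u hu
    ext l
    constructor
    · rintro ⟨q, hq, u', hu', hf, he, -, hl⟩
      rw [hpv] at hu'
      obtain ⟨u'', hu'', rfl⟩ := hu'
      dsimp only at hf he hl
      rw [hpc u'' hu''] at hf hl
      rw [key q hq u'' hu'' hf] at he
      rwa [smul_right_injective W (by positivity : ((k + 1 : ℕ) : ℝ) ≠ 0) (add_left_cancel he)]
    · intro hl
      exact ⟨_, hvi, _, hmem u hu, hfull u hu, rfl, hsub u hu hl, by rwa [hpc u hu]⟩

theorem summand_tiles (hv : IsVertex φ.M v) (hG : G.IsVCC) (hs : G.support ⊆ normalCone φ.M v)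
    {i : ℕ} (hi : i ∈ φ.supp) (hi0 : i ≠ 0) : (φ.summand G i).Tiles G.support := by
  obtain ⟨hV, hC⟩ := φ.summand_eq hv hG hs hi hi0
  refine ⟨hV ▸ hG.finite.image _, ?_, ?_, ?_, ?_⟩
  · rw [hV]
    rintro _ ⟨u, hu, rfl⟩
    dsimp only
    rw [hC u hu]
    exact (hG.polyhedral u hu).isClosed
  · rw [hV]
    rintro _ ⟨u, hu, rfl⟩
    dsimp only
    rw [hC u hu]
    exact hG.fullDim u hu
  · rw [hV]
    rintro _ ⟨u, hu, rfl⟩ _ ⟨u', hu', rfl⟩ l hl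
    dsimp only at hl ⊢
    rw [hC u hu] at hl
    simp only [map_add, map_smul, smul_eq_mul]
    have := mul_le_mul_of_nonneg_left (hG.le' u hu u' hu' l hl) (Nat.cast_nonneg (α := ℝ) i)
    linarith
  · ext l
    simp only [support, hV, Set.mem_ofPred_eq, Set.exists_mem_image]
    refine exists_congr fun u => and_congr_right fun hu => ?_
    rw [hC u hu]

/-- What the evaluation `φ(G)` is needed for: it tiles the support of `G`, and on the cone of a
vertex `w` the point `w` minimises over all the points `v_k + k u`. -/
theorem eval_tiles (h0 : 0 ∉ φ.supp) (hv : IsVertex φ.M v) (hG : G.IsVCC)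
    (hs : G.support ⊆ normalCone φ.M v) :
    (φ.eval G).Tiles G.support ∧ ∀ w ∈ (φ.eval G).verts,
      (∃ k ∈ φ.supp, ∃ u ∈ G.verts, w = φ.part v k + (k : ℝ) • u) ∧
      ∀ l ∈ (φ.eval G).cone w, ∀ k ∈ φ.supp, ∀ u ∈ G.verts,
        l w ≤ l (φ.part v k + (k : ℝ) • u) := by
  have hne : ∀ {i}, i ∈ φ.supp → i ≠ 0 := fun hi h => h0 (h ▸ hi)
  have hmem : ∀ {i}, i ∈ φ.supp.sort (· ≤ ·) ↔ i ∈ φ.supp := Finset.mem_sort _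
  obtain ⟨h1, h2⟩ := Tiles.hullList hG.support_subset_closure
    ((φ.supp.sort (· ≤ ·)).map (φ.summand G))
    (by
      obtain ⟨i, hi⟩ := φ.supp_nonempty
      simpa using List.ne_nil_of_mem (hmem.2 hi))
    (by
      intro H hH
      obtain ⟨i, hi, rfl⟩ := List.mem_map.1 hH
      exact φ.summand_tiles hv hG hs (hmem.1 hi) (hne (hmem.1 hi)))
  refine ⟨h1, fun w hw => ⟨?_, fun l hl k hk u hu => ?_⟩⟩
  · obtain ⟨H, hH, hwH⟩ := (h2 w hw).1
    obtain ⟨i, hi, rfl⟩ := List.mem_map.1 hH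
    have hi := hmem.1 hi
    rw [(φ.summand_eq hv hG hs hi (hne hi)).1] at hwH
    obtain ⟨u, hu, rfl⟩ := hwH
    exact ⟨i, hi, u, hu, rfl⟩
  · refine (h2 w hw).2 l hl _ (List.mem_map.2 ⟨k, hmem.2 hk, rfl⟩) _ ?_
    rw [(φ.summand_eq hv hG hs hk (hne hk)).1]
    exact ⟨u, hu, rfl⟩

end PolyhedralPolynomial

/-! ### Local roots and cells -/

namespace PolyhedralPolynomial

open ConeCollection

variable {W : Type*} [NormedAddCommGroup W] [NormedSpace ℝ W] (φ : PolyhedralPolynomial W)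
  {v : W} {G : ConeCollection W}

/-- A pair of distinct exponents of `φ`; such a pair `p` determines the point `ρ_p`. -/
def IsPair (p : ℕ × ℕ) : Prop := p.1 ∈ φ.supp ∧ p.2 ∈ φ.supp ∧ p.1 ≠ p.2

/-- The functionals in `N_M(v)` at which the candidate root `ρ_p` makes the `p.1`-th monomial
minimal and at which `ρ_p` is minimal among the points of `V`. -/
def cell (v : W) (V : Set W) (p : ℕ × ℕ) : Set (StrongDual ℝ W) :=
  {l | l ∈ normalCone φ.M v ∧
    (∀ k ∈ φ.supp, l (φ.part v p.1 + (p.1 : ℝ) • φ.rho v p.1 p.2) ≤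
      l (φ.part v k + (k : ℝ) • φ.rho v p.1 p.2)) ∧
    ∀ γ ∈ V, l (φ.rho v p.1 p.2) ≤ l γ}

theorem add_smul_eq_iff {i j : ℕ} (hij : i ≠ j) {u : W} :
    φ.part v i + (i : ℝ) • u = φ.part v j + (j : ℝ) • u ↔ u = φ.rho v i j := by
  have h : (i : ℝ) - j ≠ 0 := sub_ne_zero.2 (Nat.cast_injective.ne hij)
  rw [rho, ← smul_neg, eq_inv_smul_iff₀ h, sub_smul, neg_sub, sub_eq_sub_iff_add_eq_add,
    add_comm, eq_comm, add_comm _ (φ.part v i), add_comm (φ.part v j)]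

/-- For generic `φ`, the point `v_i + i γ` depends only on `γ = ρ_{i,j}`. -/
theorem IsGeneric.add_smul_eq {φ : PolyhedralPolynomial W} (hφ : φ.IsGeneric)
    (hv : IsVertex φ.M v) {p q : ℕ × ℕ} (hp : φ.IsPair p) (hq : φ.IsPair q)
    (h : φ.rho v p.1 p.2 = φ.rho v q.1 q.2) :
    φ.part v p.1 + (p.1 : ℝ) • φ.rho v p.1 p.2 = φ.part v q.1 + (q.1 : ℝ) • φ.rho v q.1 q.2 := by
  have hset := hφ v hv _ hp.1 _ hp.2.1 _ hq.1 _ hq.2.1 hp.2.2 hq.2.2 h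
  have h1 : p.1 ∈ ({q.1, q.2} : Set ℕ) := hset ▸ Set.mem_insert _ _
  rw [h]
  rcases h1 with h1 | h1
  · rw [h1]
  · rw [Set.mem_singleton_iff.1 h1]
    exact ((φ.add_smul_eq_iff hq.2.2).2 rfl).symm

theorem cell_congr {φ : PolyhedralPolynomial W} (hφ : φ.IsGeneric)
    (hv : IsVertex φ.M v) {p q : ℕ × ℕ} (hp : φ.IsPair p) (hq : φ.IsPair q)
    (h : φ.rho v p.1 p.2 = φ.rho v q.1 q.2) (V : Set W) : φ.cell v V p = φ.cell v V q := by
  unfold cell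
  rw [hφ.add_smul_eq hv hp hq h, h]

theorem isPolyhedralCone_cell [FiniteDimensional ℝ W] (hv : IsVertex φ.M v) {V : Set W}
    (hV : V.Finite) (p : ℕ × ℕ) : IsPolyhedralCone (φ.cell v V p) := by
  have h1 := isPolyhedralCone_biInter φ.supp (fun k : ℕ => {l : StrongDual ℝ W |
    l (φ.part v p.1 + (p.1 : ℝ) • φ.rho v p.1 p.2) ≤ l (φ.part v k + (k : ℝ) • φ.rho v p.1 p.2)})
    fun k _ => isPolyhedralCone_apply_le _ _
  have h2 := isPolyhedralCone_biInter hV.toFinset (fun γ => {l : StrongDual ℝ W |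
    l (φ.rho v p.1 p.2) ≤ l γ}) fun γ _ => isPolyhedralCone_apply_le _ _
  convert (φ.isPolyhedralCone_normalCone_M hv).inter (h1.inter h2) using 1
  ext l
  simp only [cell, Set.mem_inter_iff, Set.mem_ofPred_eq, Set.Finite.mem_toFinset]

/-- The points `v_k + k u` that compete in `φ(G)`. -/
theorem finite_candidates (hG : G.IsVCC) :
    (Set.image2 (fun (k : ℕ) u => φ.part v k + (k : ℝ) • u) (φ.supp : Set ℕ) G.verts).Finite :=
  Set.Finite.image2 _ φ.supp.finite_toSet hG.finite

/-- At a functional `l` separating the vertices of a root, the minimal monomial is attained for two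
exponents, which forces the vertex whose cone contains `l` to be some `ρ_{i,j}`. -/
theorem IsLocalRoot.exists_pair {φ : PolyhedralPolynomial W} (h0 : 0 ∉ φ.supp)
    (hv : IsVertex φ.M v) (h : φ.IsLocalRoot v G) {u : W} (hu : u ∈ G.verts)
    {l : StrongDual ℝ W} (hl : l ∈ G.cone u) (hinj : Set.InjOn l G.verts) :
    ∃ p, φ.IsPair p ∧ u = φ.rho v p.1 p.2 ∧
      ∀ k ∈ φ.supp, l (φ.part v p.1 + (p.1 : ℝ) • u) ≤ l (φ.part v k + (k : ℝ) • u) := by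
  obtain ⟨⟨hG, -, hroot⟩, hs⟩ := h
  obtain ⟨ht, hmin⟩ := φ.eval_tiles h0 hv hG hs
  obtain ⟨w, hw, hlw⟩ := ht.support_eq.symm ▸ (show l ∈ G.support from ⟨u, hu, hl⟩)
  have hlmin := (hmin w hw).2 l hlw
  -- A representation `w = v_i + i u'` must have `u' = u`.
  have key : ∀ i ∈ φ.supp, w ∈ (φ.summand G i).verts → w = φ.part v i + (i : ℝ) • u := by
    intro i hi hwi
    have hi0 : i ≠ 0 := fun h => h0 (h ▸ hi)
    rw [(φ.summand_eq hv hG hs hi hi0).1] at hwi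
    obtain ⟨u', hu', rfl⟩ := hwi
    have h1 := hlmin i hi u hu
    simp only [map_add, map_smul, smul_eq_mul] at h1
    have hpos : (0 : ℝ) < i := by exact_mod_cast Nat.pos_of_ne_zero hi0
    have h2 : l u' ≤ l u := le_of_mul_le_mul_left (by linarith) hpos
    rw [hinj hu' hu (le_antisymm h2 (hG.le' u hu u' hu' l hl))]
  obtain ⟨i, hi, j, hj, hij, hwi, hwj⟩ := hroot w hw
  refine ⟨(i, j), ⟨hi, hj, hij⟩, (φ.add_smul_eq_iff hij).1 ((key i hi hwi).symm.trans
    (key j hj hwj)), fun k hk => ?_⟩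
  rw [← key i hi hwi]
  exact hlmin k hk u hu

/-- Local roots are the vertex-cone collections whose vertices are points `ρ_p` and whose cones lie
in the corresponding cells. -/
theorem isLocalRoot_iff [FiniteDimensional ℝ W] {φ : PolyhedralPolynomial W} (hφ : φ.IsGeneric)
    (h0 : 0 ∉ φ.supp) (hv : IsVertex φ.M v) :
    φ.IsLocalRoot v G ↔ G.IsVCC ∧ ∀ u ∈ G.verts, ∃ p, φ.IsPair p ∧ u = φ.rho v p.1 p.2 ∧
      G.cone u ⊆ φ.cell v G.verts p := by
  constructor
  · intro h
    have hG := h.1.1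
    refine ⟨hG, fun u hu => ?_⟩
    obtain ⟨l, hl, hinj⟩ := (hG.fullDim u hu).exists_injOn hG.finite
    obtain ⟨p, hp, hup, -⟩ := h.exists_pair h0 hv hu (interior_subset hl) hinj
    refine ⟨p, hp, hup, subset_of_generic (hG.subset_closure_interior hu)
      (φ.isPolyhedralCone_cell hv hG.finite p).isClosed hG.finite fun m hm hmi => ?_⟩
    have hm := interior_subset hm
    obtain ⟨q, hq, huq, hmin⟩ := h.exists_pair h0 hv hu hm hmi
    rw [cell_congr hφ hv hp hq (hup.symm.trans huq)]
    refine ⟨h.2 ⟨u, hu, hm⟩, ?_, ?_⟩ <;> rw [← huq]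
    exacts [hmin, fun γ hγ => hG.le' u hu γ hγ m hm]
  · rintro ⟨hG, h⟩
    have hs : G.support ⊆ normalCone φ.M v := by
      rintro l ⟨u, hu, hl⟩
      obtain ⟨p, -, -, hsub⟩ := h u hu
      exact (hsub hl).1
    obtain ⟨ht, hmin⟩ := φ.eval_tiles h0 hv hG hs
    refine ⟨⟨hG, fun k hk l hl => ⟨φ.part v k, (φ.part_spec hv).1 k hk,
      (φ.mem_normalCone_M hv).1 (hs hl) k hk⟩, fun w hw => ?_⟩, hs⟩
    obtain ⟨l, hl, hinj⟩ := (ht.fullDim w hw).exists_injOn (φ.finite_candidates (v := v) hG)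
    have hl := interior_subset hl
    obtain ⟨u, hu, hlu⟩ := ht.cone_subset hw hl
    obtain ⟨⟨i, j⟩, ⟨hi, hj, hij⟩, hup, hsub⟩ := h u hu
    dsimp only at hi hj hij hup
    -- Both `w` and `v_i + i u` minimise `l` among the candidates, so they coincide.
    have hw' : w = φ.part v i + (i : ℝ) • u := by
      obtain ⟨⟨k, hk, u', hu', rfl⟩, hlw⟩ := hmin w hw
      refine hinj ⟨k, hk, u', hu', rfl⟩ ⟨i, hi, u, hu, rfl⟩ (le_antisymm (hlw l hl i hi u hu) ?_)
      have h1 := (hsub hlu).2.1 k hk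
      dsimp only at h1
      rw [← hup] at h1
      refine h1.trans ?_
      simp only [map_add, map_smul, smul_eq_mul]
      have := mul_le_mul_of_nonneg_left (hG.le' u hu u' hu' l hlu) (Nat.cast_nonneg (α := ℝ) k)
      linarith
    refine ⟨i, hi, j, hj, hij, ?_, ?_⟩
    · rw [(φ.summand_eq hv hG hs hi fun h => h0 (h ▸ hi)).1]
      exact ⟨u, hu, hw'.symm⟩
    · rw [(φ.summand_eq hv hG hs hj fun h => h0 (h ▸ hj)).1]
      exact ⟨u, hu, ((φ.add_smul_eq_iff hij).2 hup).symm.trans hw'.symm⟩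

/-- A local root is Minkowski–Weyl minimal if and only if its cones fill the cells. -/
theorem isMinkowskiWeylMinimal_iff [FiniteDimensional ℝ W] {φ : PolyhedralPolynomial W}
    (hφ : φ.IsGeneric) (h0 : 0 ∉ φ.supp) (hv : IsVertex φ.M v) :
    φ.IsMinkowskiWeylMinimal v G ↔ G.IsVCC ∧ ∀ u ∈ G.verts, ∃ p, φ.IsPair p ∧
      u = φ.rho v p.1 p.2 ∧ G.cone u = φ.cell v G.verts p := by
  classical
  constructor
  · rintro ⟨hroot, hmax⟩
    obtain ⟨hG, h⟩ := (isLocalRoot_iff hφ h0 hv).1 hroot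
    refine ⟨hG, ?_⟩
    choose! p hp hup hsub using h
    -- The collection of all the cells is a local root with a larger support.
    let G' : ConeCollection W := ⟨G.verts, fun u => φ.cell v G.verts (p u)⟩
    have hG' : G'.IsVCC := by
      refine ⟨hG.nonempty, hG.finite, fun u _ => φ.isPolyhedralCone_cell hv hG.finite _,
        fun u hu => (hG.fullDim u hu).mono (hsub u hu), fun u hu u' hu' _ l hl => ?_⟩
      have := hl.2.2 u' hu'
      rwa [← hup u hu] at this
    have hroot' : φ.IsLocalRoot v G' :=
      (isLocalRoot_iff hφ h0 hv).2 ⟨hG', fun u hu => ⟨p u, hp u hu, hup u hu, subset_rfl⟩⟩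
    have heq := hmax G' hroot' rfl fun l ⟨u, hu, hl⟩ => ⟨u, hu, hsub u hu hl⟩
    refine fun u hu => ⟨p u, hp u hu, hup u hu, (hsub u hu).antisymm ?_⟩
    refine subset_of_generic (hG'.subset_closure_interior hu) (hG.polyhedral u hu).isClosed
      hG.finite fun l hl hinj => ?_
    have hl := interior_subset hl
    obtain ⟨u', hu', hl'⟩ := heq ▸ (show l ∈ G'.support from ⟨u, hu, hl⟩)
    rwa [hinj hu hu' (le_antisymm (hG'.le' u hu u' hu' l hl) (hG.le' u' hu' u hu l hl'))]
  · rintro ⟨hG, h⟩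
    refine ⟨(isLocalRoot_iff hφ h0 hv).2 ⟨hG, fun u hu => ?_⟩, fun G' hG' hV hsub =>
      Set.Subset.antisymm ?_ hsub⟩
    · obtain ⟨p, hp, hup, he⟩ := h u hu
      exact ⟨p, hp, hup, he.subset⟩
    · rintro l ⟨u, hu, hl⟩
      obtain ⟨q, hq, huq, hq'⟩ := ((isLocalRoot_iff hφ h0 hv).1 hG').2 u hu
      rw [hV] at hu hq'
      obtain ⟨p, hp, hup, he⟩ := h u hu
      rw [cell_congr hφ hv hq hp (huq.symm.trans hup), ← he] at hq'
      exact ⟨u, hu, hq' hl⟩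

end PolyhedralPolynomial

/-! ### Regions of the arrangement and their walls -/

theorem mul_nonneg_iff_of_neg {a b : ℝ} (ha : a < 0) : 0 ≤ a * b ↔ b ≤ 0 := by
  rw [← neg_mul_neg, mul_nonneg_iff_of_pos_left (neg_pos.2 ha), neg_nonneg]

theorem mul_pos_of_same_sign {p a b : ℝ} (ha : 0 < p * a) (hb : 0 < p * b) : 0 < a * b := by
  have h2 : 0 < (p * p) * (a * b) := by nlinarith [mul_pos ha hb]
  exact pos_of_mul_pos_right h2 (mul_self_nonneg _)

namespace PolyhedralPolynomial

open ConeCollection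

variable {W : Type*} [NormedAddCommGroup W] [NormedSpace ℝ W] (φ : PolyhedralPolynomial W)
  {v : W}

theorem finite_arrangementNormals : (φ.arrangementNormals v).Finite := by
  have hs := φ.supp.finite_toSet
  have h1 := ((hs.prod (hs.prod hs)).image fun q : ℕ × ℕ × ℕ =>
    (φ.part v q.2.2 + (q.2.2 : ℝ) • φ.rho v q.1 q.2.1) -
      (φ.part v q.1 + (q.1 : ℝ) • φ.rho v q.1 q.2.1))
  have h2 := ((hs.prod hs).prod (hs.prod hs)).image fun q : (ℕ × ℕ) × (ℕ × ℕ) =>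
    φ.rho v q.1.1 q.1.2 - φ.rho v q.2.1 q.2.2
  refine (h1.union h2).subset ?_
  rintro x ⟨-, ⟨i, hi, j, hj, k, hk, -, rfl⟩ | ⟨i, hi, j, hj, i', hi', j', hj', -, -, rfl⟩⟩
  · exact .inl ⟨(i, j, k), ⟨hi, hj, hk⟩, rfl⟩
  · exact .inr ⟨((i, j), (i', j')), ⟨⟨hi, hj⟩, hi', hj'⟩, rfl⟩

/-- The closed region of `N_M(v)` not strictly separated from `μ₀` by the arrangement. -/
def region (v : W) (μ₀ : StrongDual ℝ W) : Set (StrongDual ℝ W) :=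
  {μ ∈ normalCone φ.M v | ∀ x ∈ φ.arrangementNormals v, 0 ≤ μ₀ x * μ x}

theorem mem_region_self {μ : StrongDual ℝ W} (h : μ ∈ normalCone φ.M v) : μ ∈ φ.region v μ :=
  ⟨h, fun _ _ => mul_self_nonneg _⟩

theorem isClosed_region (μ₀ : StrongDual ℝ W) : IsClosed (φ.region v μ₀) := by
  have : φ.region v μ₀ = normalCone φ.M v ∩
      ⋂ x ∈ φ.arrangementNormals v, {μ | μ 0 ≤ μ (μ₀ x • x)} := by
    ext; simp [region]
  rw [this]
  exact (isClosed_normalCone _ _).inter (isClosed_biInter fun x _ => isClosed_setOf_apply_le _ _)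

theorem mem_interior_region {μ : StrongDual ℝ W} (h : μ ∈ interior (normalCone φ.M v))
    (hx : ∀ x ∈ φ.arrangementNormals v, μ x ≠ 0) : μ ∈ interior (φ.region v μ) := by
  refine mem_interior.2 ⟨interior (normalCone φ.M v) ∩
    ⋂ x ∈ φ.arrangementNormals v, {l | l 0 < l (μ x • x)}, ?_,
    isOpen_interior.inter (φ.finite_arrangementNormals.isOpen_biInter
      fun x _ => isOpen_setOf_apply_lt _ _), h, ?_⟩
  · rintro l ⟨hl, hl'⟩
    refine ⟨interior_subset hl, fun x hx => ?_⟩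
    have := Set.mem_iInter₂.1 hl' x hx
    simp only [Set.mem_ofPred_eq, map_zero, map_smul, smul_eq_mul] at this
    exact this.le
  · refine Set.mem_iInter₂.2 fun x hx' => ?_
    simpa using mul_self_pos.2 (hx x hx')

variable {φ}

theorem region_congr {μ μ' : StrongDual ℝ W}
    (h : ∀ x ∈ φ.arrangementNormals v, 0 < μ x * μ' x) : φ.region v μ = φ.region v μ' := by
  ext l
  refine and_congr_right fun _ => forall₂_congr fun x hx => ?_
  rcases pos_and_pos_or_neg_and_neg_of_mul_pos (h x hx) with h | h
  · rw [mul_nonneg_iff_of_pos_left h.1, mul_nonneg_iff_of_pos_left h.2]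
  · rw [mul_nonneg_iff_of_neg h.1, mul_nonneg_iff_of_neg h.2]

theorem isMaxCone_region {μ : StrongDual ℝ W} (h : μ ∈ interior (normalCone φ.M v))
    (hx : ∀ x ∈ φ.arrangementNormals v, μ x ≠ 0) : φ.IsMaxCone v (φ.region v μ) :=
  ⟨μ, h, hx, rfl⟩

theorem IsMaxCone.isClosed {C : Set (StrongDual ℝ W)} (h : φ.IsMaxCone v C) : IsClosed C := by
  obtain ⟨μ, -, -, rfl⟩ := h
  exact φ.isClosed_region μ

theorem IsMaxCone.fullDim {C : Set (StrongDual ℝ W)} (h : φ.IsMaxCone v C) : FullDim C := by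
  obtain ⟨μ, hμ, hx, rfl⟩ := h
  exact ⟨μ, φ.mem_interior_region hμ hx⟩

theorem IsMaxCone.subset {C : Set (StrongDual ℝ W)} (h : φ.IsMaxCone v C) :
    C ⊆ normalCone φ.M v := by
  obtain ⟨μ, -, -, rfl⟩ := h
  exact fun l hl => hl.1

theorem finite_setOf_isMaxCone : {C | φ.IsMaxCone v C}.Finite := by
  -- A maximal cone is determined by the normals that are positive on it.
  refine ((φ.finite_arrangementNormals (v := v)).finite_subsets.image fun s =>
    {μ | μ ∈ normalCone φ.M v ∧ ∀ x ∈ φ.arrangementNormals v,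
      (x ∈ s → 0 ≤ μ x) ∧ (x ∉ s → μ x ≤ 0)}).subset ?_
  rintro C ⟨μ₀, -, hx, rfl⟩
  refine ⟨{x ∈ φ.arrangementNormals v | 0 < μ₀ x}, fun x hx => hx.1, ?_⟩
  ext μ
  refine and_congr_right fun _ => forall₂_congr fun x hxn => ?_
  rcases (hx x hxn).lt_or_gt with h | h
  · simp [h.not_gt, mul_nonneg_iff_of_neg h]
  · simp [hxn, h]

theorem isClosed_sUnion_isMaxCone {F : Set (Set (StrongDual ℝ W))}
    (hF : ∀ C ∈ F, φ.IsMaxCone v C) : IsClosed (⋃₀ F) := by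
  rw [Set.sUnion_eq_biUnion]
  exact (finite_setOf_isMaxCone.subset hF).isClosed_biUnion fun C hC => (hF C hC).isClosed

/-- Within a region no inequality between points with difference in the arrangement changes. -/
theorem apply_le_of_mem_region {μ₀ μ : StrongDual ℝ W} {a b : W}
    (hx : ∀ x ∈ φ.arrangementNormals v, μ₀ x ≠ 0) (hμ : μ ∈ φ.region v μ₀) (h : μ₀ a ≤ μ₀ b)
    (hab : b - a ≠ 0 → b - a ∈ φ.arrangementNormals v) : μ a ≤ μ b := by
  by_cases h0 : b - a = 0
  · rw [sub_eq_zero.1 h0]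
  · have hmem := hab h0
    have h1 := hμ.2 _ hmem
    have h2 := hx _ hmem
    have h3 : 0 < μ₀ (b - a) := lt_of_le_of_ne (by rw [map_sub]; linarith) (Ne.symm h2)
    have h4 := nonneg_of_mul_nonneg_right h1 h3
    rw [map_sub] at h4
    linarith

theorem region_subset_cell {μ₀ : StrongDual ℝ W} {V : Set W} {p : ℕ × ℕ} (hp : φ.IsPair p)
    (hV : ∀ γ ∈ V, ∃ q, φ.IsPair q ∧ γ = φ.rho v q.1 q.2)
    (hx : ∀ x ∈ φ.arrangementNormals v, μ₀ x ≠ 0) (h : μ₀ ∈ φ.cell v V p) :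
    φ.region v μ₀ ⊆ φ.cell v V p := by
  refine fun μ hμ => ⟨hμ.1, fun k hk => ?_, fun γ hγ => ?_⟩
  · exact apply_le_of_mem_region hx hμ (h.2.1 k hk) fun h0 =>
      ⟨h0, .inl ⟨p.1, hp.1, p.2, hp.2.1, k, hk, hp.2.2, rfl⟩⟩
  · refine apply_le_of_mem_region hx hμ (h.2.2 γ hγ) fun h0 => ⟨h0, .inr ?_⟩
    obtain ⟨q, hq, rfl⟩ := hV γ hγ
    exact ⟨q.1, hq.1, q.2, hq.2.1, p.1, hp.1, p.2, hp.2.1, hq.2.2, hp.2.2, rfl⟩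

theorem apply_ne_zero_of_injOn {l : StrongDual ℝ W}
    (h : Set.InjOn l (insert 0 (φ.arrangementNormals v))) :
    ∀ x ∈ φ.arrangementNormals v, l x ≠ 0 := fun x hx h0 =>
  hx.1 (h (.inr hx) (.inl rfl) (by rw [h0, map_zero]))

/-- A full-dimensional cell is the union of the maximal cones contained in it. -/
theorem exists_isMaxCone_of_mem_cell [FiniteDimensional ℝ W] (hv : IsVertex φ.M v) {V : Set W}
    (hVf : V.Finite) {p : ℕ × ℕ} (hp : φ.IsPair p)
    (hV : ∀ γ ∈ V, ∃ q, φ.IsPair q ∧ γ = φ.rho v q.1 q.2) (hfull : FullDim (φ.cell v V p))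
    {l : StrongDual ℝ W} (hl : l ∈ φ.cell v V p) :
    ∃ C, φ.IsMaxCone v C ∧ C ⊆ φ.cell v V p ∧ l ∈ C := by
  have hcl : IsClosed (⋃₀ {C | φ.IsMaxCone v C ∧ C ⊆ φ.cell v V p}) :=
    isClosed_sUnion_isMaxCone fun C hC => hC.1
  have hsub := subset_of_generic (subset_closure_interior
    (φ.isPolyhedralCone_cell hv hVf p).convex hfull) hcl
    ((φ.finite_arrangementNormals (v := v)).insert 0) fun m hm hinj =>
      have hx := apply_ne_zero_of_injOn hinj
      have hmc := interior_subset hm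
      ⟨φ.region v m, ⟨isMaxCone_region (interior_mono (fun _ h => h.1) hm) hx,
        region_subset_cell hp hV hx hmc⟩, φ.mem_region_self hmc.1⟩
  obtain ⟨C, hC, hlC⟩ := hsub hl
  exact ⟨C, hC.1, hC.2, hlC⟩

theorem eventually_mul_pos (p h : StrongDual ℝ W) :
    ∀ᶠ ε : ℝ in nhdsWithin 0 (Set.Ioi 0), ∀ y ∈ φ.arrangementNormals v, p y ≠ 0 →
      0 < p y * (p + ε • h) y := by
  refine (φ.finite_arrangementNormals.eventually_all).2 fun y _ => ?_
  by_cases hy : p y = 0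
  · simp [hy]
  · have hc : Continuous fun ε : ℝ => p y * (p + ε • h) y := by
      simp only [add_apply, smul_apply]
      fun_prop
    have hlt : 0 < p y * (p + (0 : ℝ) • h) y := by simpa using mul_self_pos.2 hy
    filter_upwards [nhdsWithin_le_nhds (hc.continuousAt.eventually (lt_mem_nhds hlt))]
      with ε hε _ using hε

theorem eventually_mem_interior {A : Set (StrongDual ℝ W)} {p : StrongDual ℝ W}
    (hp : p ∈ interior A) (h : StrongDual ℝ W) :
    ∀ᶠ ε : ℝ in nhdsWithin 0 (Set.Ioi 0), p + ε • h ∈ interior A := by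
  have hc : Continuous fun ε : ℝ => p + ε • h := by fun_prop
  have h0 : p + (0 : ℝ) • h ∈ interior A := by simpa using hp
  exact nhdsWithin_le_nhds (hc.continuousAt.eventually (isOpen_interior.mem_nhds h0))

/-- The part of the hyperplane `x = 0` in `N_M(v)` that lies, for each hyperplane of the arrangement
not through `p`, on the same side as `p`. -/
def wall (φ : PolyhedralPolynomial W) (v : W) (p : StrongDual ℝ W) (x : W) :
    Set (StrongDual ℝ W) :=
  {l | l ∈ normalCone φ.M v ∧ l x = 0 ∧ ∀ y ∈ φ.arrangementNormals v, p y ≠ 0 → 0 ≤ p y * l y}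

/-- The wall at `p` contains a neighbourhood of `p` in the hyperplane `x = 0`. -/
theorem finrank_span_wall [FiniteDimensional ℝ W] {p : StrongDual ℝ W} {x : W}
    (hp : p ∈ interior (normalCone φ.M v)) (hx0 : x ≠ 0) (hpx : p x = 0) :
    Module.finrank ℝ (Submodule.span ℝ (wall φ v p x)) + 1 = Module.finrank ℝ W := by
  let e : StrongDual ℝ W →ₗ[ℝ] ℝ := (ContinuousLinearMap.apply ℝ ℝ x).toLinearMap
  have he : e ≠ 0 := by
    intro h
    obtain ⟨l, -, hl⟩ := (dense_apply_ne_zero hx0).inter_open_nonempty _ isOpen_univ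
      Set.univ_nonempty
    exact hl (by simpa [e] using congrArg (fun g => g l) h)
  have hspan : Submodule.span ℝ (wall φ v p x) = LinearMap.ker e := by
    refine le_antisymm (Submodule.span_le.2 fun l hl => by simpa [e] using hl.2.1) fun h hh => ?_
    have hhx : h x = 0 := by simpa [e] using hh
    obtain ⟨ε, ⟨h1, h2⟩, hε⟩ := ((eventually_mem_interior hp h).and
      (eventually_mul_pos (φ := φ) (v := v) p h)).and self_mem_nhdsWithin |>.exists
    have hmem : p + ε • h ∈ wall φ v p x :=
      ⟨interior_subset h1, by simp [hpx, hhx], fun y hy hpy => (h2 y hy hpy).le⟩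
    have hmem' : p ∈ wall φ v p x :=
      ⟨interior_subset hp, hpx, fun y _ _ => mul_self_nonneg _⟩
    have h3 := Submodule.smul_mem _ ε⁻¹
      (Submodule.sub_mem _ (Submodule.subset_span hmem) (Submodule.subset_span hmem'))
    rwa [add_sub_cancel_left, inv_smul_smul₀ (ne_of_gt hε)] at h3
  rw [hspan, Module.Dual.finrank_ker_add_one_of_ne_zero (f := e) he,
    ← (LinearMap.toContinuousLinearMap (𝕜 := ℝ) (E := W) (F' := ℝ)).finrank_eq]
  exact Subspace.dual_finrank_eq

/-- If only the hyperplane `x = 0` passes through `p`, the wall at `p` is a facet of each region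
that contains `p`; the signs of `m` agree with those of `p` off this hyperplane. -/
theorem isFacet_wall [FiniteDimensional ℝ W] {p m : StrongDual ℝ W} {x : W}
    (hp : p ∈ interior (normalCone φ.M v)) (hx : x ∈ φ.arrangementNormals v) (hpx : p x = 0)
    (hpar : ∀ y ∈ φ.arrangementNormals v, p y = 0 → ∃ r : ℝ, y = r • x)
    (hm : ∀ y ∈ φ.arrangementNormals v, m y ≠ 0)
    (hmp : ∀ y ∈ φ.arrangementNormals v, p y ≠ 0 → 0 < p y * m y) :
    IsFacet (wall φ v p x) (φ.region v m) := by
  refine ⟨⟨m x • x, fun l hl => by simpa using hl.2 x hx, ?_⟩, finrank_span_wall hp hx.1 hpx⟩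
  ext l
  have key : ∀ y ∈ φ.arrangementNormals v, p y ≠ 0 → (0 ≤ p y * l y ↔ 0 ≤ m y * l y) := by
    intro y hy hpy
    rcases pos_and_pos_or_neg_and_neg_of_mul_pos (hmp y hy hpy) with h | h
    · rw [mul_nonneg_iff_of_pos_left h.1, mul_nonneg_iff_of_pos_left h.2]
    · rw [mul_nonneg_iff_of_neg h.1, mul_nonneg_iff_of_neg h.2]
  have hlx : l (m x • x) = 0 ↔ l x = 0 := by simp [hm x hx]
  constructor
  · rintro ⟨hN, hl0, h⟩
    refine ⟨⟨hN, fun y hy => ?_⟩, hlx.2 hl0⟩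
    by_cases hpy : p y = 0
    · obtain ⟨r, rfl⟩ := hpar y hy hpy
      simp [hl0]
    · exact (key y hy hpy).1 (h y hy hpy)
  · rintro ⟨⟨hN, h⟩, hl0⟩
    exact ⟨hN, hlx.1 hl0, fun y hy hpy => (key y hy hpy).2 (h y hy)⟩

/-- Two regions at a point on a single wall coincide if they lie on the same side of it. -/
theorem region_eq_of_same_side {p m m' : StrongDual ℝ W} {x : W}
    (hpar : ∀ y ∈ φ.arrangementNormals v, p y = 0 → ∃ r : ℝ, y = r • x)
    (hmp : ∀ y ∈ φ.arrangementNormals v, p y ≠ 0 → 0 < p y * m y)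
    (hmp' : ∀ y ∈ φ.arrangementNormals v, p y ≠ 0 → 0 < p y * m' y)
    (h : 0 < m x * m' x) : φ.region v m = φ.region v m' := by
  refine region_congr fun y hy => ?_
  by_cases hpy : p y = 0
  · obtain ⟨r, rfl⟩ := hpar y hy hpy
    have hr : r ≠ 0 := fun h0 => hy.1 (by rw [h0, zero_smul])
    simp only [map_smul, smul_eq_mul]
    have := mul_pos (mul_self_pos.2 hr) h
    linarith
  · exact mul_pos_of_same_sign (hmp y hy hpy) (hmp' y hy hpy)

theorem mul_pos_of_mem_region {p c : StrongDual ℝ W} (hc : ∀ y ∈ φ.arrangementNormals v, c y ≠ 0)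
    (hp : p ∈ φ.region v c) :
    ∀ y ∈ φ.arrangementNormals v, p y ≠ 0 → 0 < p y * c y := fun y hy hpy =>
  lt_of_le_of_ne (by rw [mul_comm]; exact hp.2 y hy) (mul_ne_zero hpy (hc y hy)).symm

/-- If finitely many maximal cones do not cover a convex set `K` containing them, some wall inside
`K` separates one of them from a maximal cone outside the family, and no other maximal cone
contains that wall. -/
theorem exists_crossing [FiniteDimensional ℝ W] {F : Set (Set (StrongDual ℝ W))}
    (hF : ∀ C ∈ F, φ.IsMaxCone v C) (hne : F.Nonempty) {K : Set (StrongDual ℝ W)}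
    (hK : Convex ℝ K) (hKN : K ⊆ normalCone φ.M v) (hFK : ⋃₀ F ⊆ K) (hnot : ¬ K ⊆ ⋃₀ F) :
    ∃ C ∈ F, ∃ μ ∈ K, (∀ x ∈ φ.arrangementNormals v, μ x ≠ 0) ∧
      φ.IsMaxCone v (φ.region v μ) ∧ φ.region v μ ∉ F ∧ ∃ f, IsFacet f C ∧
        IsFacet f (φ.region v μ) ∧
        ∀ C', φ.IsMaxCone v C' → f ⊆ C' → C' = C ∨ C' = φ.region v μ := by
  have hUcl : IsClosed (⋃₀ F) := isClosed_sUnion_isMaxCone hF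
  obtain ⟨C₀, hC₀⟩ := hne
  obtain ⟨l₀, hl₀N, hl₀x, hC₀eq⟩ := hF C₀ hC₀
  have hl₀C : l₀ ∈ interior C₀ := hC₀eq ▸ φ.mem_interior_region hl₀N hl₀x
  have hC₀K : C₀ ⊆ K := (Set.subset_sUnion_of_mem hC₀).trans hFK
  have hl₀K : l₀ ∈ interior K := interior_mono hC₀K hl₀C
  -- A point `μ₁` of `K` off the family, such that the segment from `l₀` to `μ₁` meets at most one
  -- hyperplane of the arrangement at a time.
  let A : Set W := insert 0 (Set.image2 (fun x y => l₀ x • y - l₀ y • x)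
    (φ.arrangementNormals v) (φ.arrangementNormals v))
  have hA : A.Finite :=
    (Set.Finite.image2 _ φ.finite_arrangementNormals φ.finite_arrangementNormals).insert 0
  obtain ⟨μ₁, hμ₁K, hμ₁A, hμ₁U⟩ : ∃ μ₁ ∈ interior K, Set.InjOn μ₁ A ∧ μ₁ ∉ ⋃₀ F := by
    by_contra! h
    exact hnot (subset_of_generic (subset_closure_interior hK ⟨l₀, hl₀K⟩) hUcl hA h)
  let m : ℝ → StrongDual ℝ W := fun t => l₀ + t • (μ₁ - l₀)
  have hmc : Continuous m := by fun_prop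
  have hmK : ∀ t ∈ Set.Icc (0 : ℝ) 1, m t ∈ interior K := fun t ht =>
    hK.interior.add_smul_sub_mem hl₀K hμ₁K ht
  -- The last point `p = m s` of the segment in the family.
  obtain ⟨s, ⟨hs, hsU⟩, hsmax⟩ := (isCompact_Icc.inter_right (hUcl.preimage hmc)).exists_isGreatest
    (s := Set.Icc (0 : ℝ) 1 ∩ m ⁻¹' ⋃₀ F)
    ⟨0, by simp, by simpa [m] using ⟨C₀, hC₀, interior_subset hl₀C⟩⟩
  have hm1 : m 1 = μ₁ := by simp [m]
  have hs1 : s < 1 := lt_of_le_of_ne hs.2 fun h => hμ₁U (by rw [← hm1, ← h]; exact hsU)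
  have hpK := hmK s hs
  have hpN := interior_mono hKN hpK
  obtain ⟨C, hCF, hpC⟩ := hsU
  obtain ⟨c, hcN, hcx, hCeq⟩ := hF C hCF
  have hCeq : C = φ.region v c := hCeq
  subst hCeq
  have hcp := mul_pos_of_mem_region hcx hpC
  -- A point `μ = m (s + ε)` just after `p`.
  obtain ⟨ε, ⟨hε, hε1⟩, hε0⟩ := (((eventually_mul_pos (φ := φ) (v := v) (m s) (μ₁ - l₀)).and
    (nhdsWithin_le_nhds (gt_mem_nhds (sub_pos.2 hs1)))).and self_mem_nhdsWithin).exists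
  have hε0 : 0 < ε := hε0
  have hμeq : m s + ε • (μ₁ - l₀) = m (s + ε) := by simp only [m]; module
  rw [hμeq] at hε
  set μ := m (s + ε) with hμ
  have hsε : s + ε ∈ Set.Icc (0 : ℝ) 1 := ⟨by linarith [hs.1], by linarith⟩
  have hμK : μ ∈ interior K := hmK _ hsε
  have hμU : μ ∉ ⋃₀ F := fun h => by linarith [hsmax ⟨hsε, h⟩]
  have hs0 : ∀ y ∈ φ.arrangementNormals v, m s y = 0 → s ≠ 0 := fun y hy h h0 =>
    hl₀x y hy (by simpa [m, h0] using h)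
  have hμx : ∀ y ∈ φ.arrangementNormals v, μ y ≠ 0 := by
    intro y hy h
    by_cases hpy : m s y = 0
    · rw [← hμeq, add_apply, hpy, zero_add, smul_apply, smul_eq_mul] at h
      have h1 : (μ₁ - l₀) y = 0 := (mul_eq_zero.1 h).resolve_left hε0.ne'
      refine hl₀x y hy ?_
      simpa [m, h1] using hpy
    · exact absurd (hε y hy hpy) (by rw [h, mul_zero]; exact lt_irrefl _)
  have hμN := interior_mono hKN hμK
  have hDF : φ.region v μ ∉ F := fun h =>
    hμU ⟨_, h, φ.mem_region_self (interior_subset hμN)⟩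
  obtain ⟨x, hx, hpx⟩ : ∃ x ∈ φ.arrangementNormals v, m s x = 0 := by
    by_contra! h
    refine hDF ?_
    rwa [← region_congr fun y hy => mul_pos_of_same_sign (hcp y hy (h y hy)) (hε y hy (h y hy))]
  have hpar : ∀ y ∈ φ.arrangementNormals v, m s y = 0 → ∃ r : ℝ, y = r • x := by
    intro y hy hpy
    have hz : l₀ x • y - l₀ y • x = 0 := by
      refine hμ₁A (.inr ⟨x, hx, y, hy, rfl⟩) (.inl rfl) ?_
      have h1 : s * (μ₁ - l₀) x = - l₀ x := by
        simp only [m, add_apply, smul_apply, smul_eq_mul] at hpx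
        linarith
      have h2 : s * (μ₁ - l₀) y = - l₀ y := by
        simp only [m, add_apply, smul_apply, smul_eq_mul] at hpy
        linarith
      simp only [sub_apply] at h1 h2
      refine mul_left_cancel₀ (hs0 y hy hpy) ?_
      simp only [map_sub, map_smul, smul_eq_mul, map_zero, mul_zero]
      linear_combination l₀ x * h2 - l₀ y * h1
    refine ⟨(l₀ x)⁻¹ * l₀ y, ?_⟩
    rw [mul_smul, ← sub_eq_zero.1 hz, inv_smul_smul₀ (hl₀x x hx)]
  have hside : c x * μ x < 0 := by
    refine lt_of_le_of_ne (not_lt.1 fun h => hDF ?_) (mul_ne_zero (hcx x hx) (hμx x hx))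
    rwa [← region_eq_of_same_side hpar hcp hε h]
  refine ⟨_, hCF, μ, interior_subset hμK, hμx, isMaxCone_region hμN hμx, hDF, wall φ v (m s) x,
    isFacet_wall hpN hx hpx hpar hcx hcp, isFacet_wall hpN hx hpx hpar hμx hε, ?_⟩
  rintro _ ⟨c', hc'N, hc'x, rfl⟩ hsub
  have hp' : m s ∈ φ.region v c' :=
    hsub ⟨interior_subset hpN, hpx, fun _ _ _ => mul_self_nonneg _⟩
  have hcp' := mul_pos_of_mem_region hc'x hp'
  rcases (mul_ne_zero (hc'x x hx) (hcx x hx)).lt_or_gt with h | h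
  · refine .inr (region_eq_of_same_side hpar hcp' hε ?_)
    exact mul_pos_of_same_sign (p := -c x) (by linarith) (by linarith)
  · exact .inl (region_eq_of_same_side hpar hcp' hcp h)

end PolyhedralPolynomial

/-! ### Local compatible systems -/

namespace PolyhedralPolynomial

open ConeCollection

variable {W : Type*} [NormedAddCommGroup W] [NormedSpace ℝ W] [FiniteDimensional ℝ W]
  {φ : PolyhedralPolynomial W} {v : W} {P : ConeCollection W}

/-- A minimal local root is cut into the maximal cones of the fan contained in its cells; these
form a local compatible system. -/
theorem exists_localCompatibleSystem (hv : IsVertex φ.M v) (hP : P.IsVCC)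
    (h : ∀ u ∈ P.verts, ∃ p, φ.IsPair p ∧ u = φ.rho v p.1 p.2 ∧ P.cone u = φ.cell v P.verts p) :
    ∃ L : φ.LocalCompatibleSystem v, L.support ⊆ normalCone φ.M v ∧ P.SameAs L.vcc := by
  choose! p hp hup hcone using h
  have hV : ∀ γ ∈ P.verts, ∃ q, φ.IsPair q ∧ γ = φ.rho v q.1 q.2 :=
    fun γ hγ => ⟨p γ, hp γ hγ, hup γ hγ⟩
  let F : Set (Set (StrongDual ℝ W)) := {C | φ.IsMaxCone v C ∧ ∃ u ∈ P.verts, C ⊆ P.cone u}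
  have hF : F.Finite := finite_setOf_isMaxCone.subset fun C hC => hC.1
  have : Finite F := hF
  let e : F ≃ Fin (Nat.card F) := Finite.equivFin F
  choose g hg hsub using fun C : F => C.2.2
  have huniq : ∀ (C : F) u, u ∈ P.verts → (C : Set (StrongDual ℝ W)) ⊆ P.cone u → g C = u :=
    fun C u hu hCu => hP.eq_of_fullDim_inter (hg C) hu
      (C.2.1.fullDim.mono (Set.subset_inter (hsub C) hCu))
  have hrho : ∀ C : F, φ.rho v (p (g C)).1 (p (g C)).2 = g C := fun C => (hup _ (hg C)).symm
  have hunion : ∀ u ∈ P.verts, {μ | ∃ k, φ.rho v (p (g (e.symm k))).1 (p (g (e.symm k))).2 = u ∧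
      μ ∈ (e.symm k : Set (StrongDual ℝ W))} = P.cone u := by
    intro u hu
    ext μ
    constructor
    · rintro ⟨k, hk, hμ⟩
      rw [hrho] at hk
      exact hk ▸ hsub _ hμ
    · intro hμ
      rw [hcone u hu] at hμ
      obtain ⟨C, hC, hCs, hμC⟩ := exists_isMaxCone_of_mem_cell hv hP.finite (hp u hu) hV
        (hcone u hu ▸ hP.fullDim u hu) hμ
      rw [← hcone u hu] at hCs
      refine ⟨e ⟨C, hC, u, hu, hCs⟩, ?_, ?_⟩
      · rw [hrho, e.symm_apply_apply]
        exact huniq _ u hu hCs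
      · rwa [e.symm_apply_apply]
  have hcell : ∀ C : F, (C : Set (StrongDual ℝ W)) ⊆ φ.cell v P.verts (p (g C)) :=
    fun C => hcone _ (hg C) ▸ hsub C
  let L : φ.LocalCompatibleSystem v :=
    { t := Nat.card F
      C := fun k => e.symm k
      I := fun k => p (g (e.symm k))
      C_injective := Subtype.val_injective.comp e.symm.injective
      isMaxCone := fun k => (e.symm k).2.1
      fst_mem := fun k => (hp _ (hg _)).1
      snd_mem := fun k => (hp _ (hg _)).2.1
      fst_ne_snd := fun k => (hp _ (hg _)).2.2
      polyhedral := fun k => by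
        rw [hrho (e.symm k), hunion _ (hg _)]
        exact hP.polyhedral _ (hg _)
      primary := fun k i hi μ hμ => (hcell _ hμ).2.1 i hi
      secondary := fun α β _ μ hμ => by
        rw [hrho (e.symm β)]
        exact (hcell _ hμ).2.2 _ (hg _)
      boundary := fun f l _ _ D hD hDL _ => by
        -- A maximal cone with all the labels lies in a cell, hence belongs to the system.
        by_contra! hlab
        obtain ⟨hprim, hsec⟩ := hlab
        have hDcone : D ⊆ P.cone (g (e.symm l)) := by
          rw [hcone _ (hg _)]
          refine fun μ hμ => ⟨hD.subset hμ, fun i hi => hprim i hi μ hμ, fun γ hγ => ?_⟩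
          obtain ⟨m, hm⟩ := hP.fullDim γ hγ
          obtain ⟨k, hk, -⟩ := (hunion γ hγ).symm ▸ interior_subset hm
          rw [← hk]
          exact hsec k μ hμ
        refine hDL (e ⟨D, hD, _, hg _, hDcone⟩) ?_
        rw [e.symm_apply_apply] }
  refine ⟨L, Set.iUnion_subset fun k => (L.isMaxCone k).subset, ?_, fun u hu => (hunion u hu).symm⟩
  ext u
  constructor
  · intro hu
    obtain ⟨m, hm⟩ := hP.fullDim u hu
    obtain ⟨k, hk, -⟩ := (hunion u hu).symm ▸ interior_subset hm
    exact ⟨k, hk⟩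
  · rintro ⟨k, rfl⟩
    exact Set.mem_of_eq_of_mem (hrho (e.symm k)) (hg _)

/-- The cones of a local compatible system carrying the point `ρ_{I l}` fill the cell of that
point: otherwise a wall inside the cell would violate the boundary condition. -/
theorem LocalCompatibleSystem.vcc_cone_eq (hφ : φ.IsGeneric) (hv : IsVertex φ.M v)
    (L : φ.LocalCompatibleSystem v) (k : Fin L.t) :
    L.vcc.cone (φ.rho v (L.I k).1 (L.I k).2) = φ.cell v L.vcc.verts (L.I k) := by
  have hpair : ∀ k, φ.IsPair (L.I k) := fun k => ⟨L.fst_mem k, L.snd_mem k, L.fst_ne_snd k⟩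
  have hV : ∀ γ ∈ L.vcc.verts, ∃ q, φ.IsPair q ∧ γ = φ.rho v q.1 q.2 := by
    rintro _ ⟨β, rfl⟩
    exact ⟨L.I β, hpair β, rfl⟩
  have hcell : ∀ k, L.C k ⊆ φ.cell v L.vcc.verts (L.I k) := by
    refine fun k μ hμ => ⟨(L.isMaxCone k).subset hμ, fun i hi => L.primary k i hi μ hμ, ?_⟩
    rintro _ ⟨β, rfl⟩
    by_cases h : k = β
    · rw [h]
    · exact L.secondary k β h μ hμ
  let F : Set (Set (StrongDual ℝ W)) :=
    {C | ∃ k', φ.rho v (L.I k').1 (L.I k').2 = φ.rho v (L.I k).1 (L.I k).2 ∧ L.C k' = C}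
  have hFU : ⋃₀ F = L.vcc.cone (φ.rho v (L.I k).1 (L.I k).2) := by
    ext μ
    constructor
    · rintro ⟨_, ⟨k', hk', rfl⟩, hμ⟩
      exact ⟨k', hk', hμ⟩
    · rintro ⟨k', hk', hμ⟩
      exact ⟨_, ⟨k', hk', rfl⟩, hμ⟩
  have hsub : ⋃₀ F ⊆ φ.cell v L.vcc.verts (L.I k) := by
    rintro μ ⟨_, ⟨k', hk', rfl⟩, hμ⟩
    rw [← cell_congr hφ hv (hpair k') (hpair k) hk']
    exact hcell k' hμ
  rw [← hFU]
  refine hsub.antisymm ?_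
  by_contra hnot
  obtain ⟨_, ⟨l, hl, rfl⟩, μ, hμ, hμx, hD, hDF, f, hfC, hfD, honly⟩ := exists_crossing (F := F)
    (by rintro _ ⟨k', -, rfl⟩; exact L.isMaxCone k') ⟨_, k, rfl, rfl⟩
    (φ.isPolyhedralCone_cell hv (Set.finite_range _) _).convex (fun _ h => h.1) hsub hnot
  rw [cell_congr hφ hv (hpair k) (hpair l) hl.symm] at hμ
  have hDcell := region_subset_cell (hpair l) hV hμx hμ
  -- The new maximal cone is in no other part of the system, since cells of different points have
  -- disjoint interiors.
  have hDL : ∀ k', φ.region v μ ≠ L.C k' := by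
    intro k' he
    refine hDF ⟨k', ?_, he.symm⟩
    rw [← hl]
    exact eq_of_fullDim hD.fullDim fun m hm => le_antisymm
      ((hcell k' (he ▸ hm)).2.2 _ ⟨l, rfl⟩) ((hDcell hm).2.2 _ ⟨k', rfl⟩)
  have hfsub : ∀ {C : Set (StrongDual ℝ W)}, IsFacet f C → f ⊆ C := by
    rintro C ⟨⟨x, -, rfl⟩, -⟩
    exact fun _ h => h.1
  rcases L.boundary f l hfC (fun k' hk' => L.C_injective
    ((honly _ (L.isMaxCone k') (hfsub hk')).resolve_right fun h => hDL k' h.symm)) _ hD hDL hfD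
    with h | ⟨β, h⟩
  · exact h fun i hi m hm => (hDcell hm).2.1 i hi
  · exact h fun m hm => (hDcell hm).2.2 _ ⟨β, rfl⟩

end PolyhedralPolynomial

end PolyRoot

theorem mainTheorem2 {n : ℕ}
    (φ : PolyRoot.PolyhedralPolynomial (EuclideanSpace ℝ (Fin n)))
    (hφ : φ.IsGeneric) (h0 : 0 ∉ φ.supp)
    (v : EuclideanSpace ℝ (Fin n)) (hv : PolyRoot.IsVertex φ.M v)
    (P : PolyRoot.ConeCollection (EuclideanSpace ℝ (Fin n)))
    (hP : P.IsVCC) (hPv : P.support ⊆ PolyRoot.normalCone φ.M v) :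
    φ.IsMinkowskiWeylMinimal v P ↔
      ∃ L : φ.LocalCompatibleSystem v,
        L.support ⊆ PolyRoot.normalCone φ.M v ∧ P.SameAs L.vcc := by
  rw [PolyRoot.PolyhedralPolynomial.isMinkowskiWeylMinimal_iff hφ h0 hv]
  constructor
  · rintro ⟨-, h⟩
    exact PolyRoot.PolyhedralPolynomial.exists_localCompatibleSystem hv hP h
  · rintro ⟨L, -, hverts, hcones⟩
    refine ⟨hP, fun u hu => ?_⟩
    rw [hcones u hu, hverts]
    rw [hverts] at hu
    obtain ⟨k, rfl⟩ := hu
    exact ⟨L.I k, ⟨L.fst_mem k, L.snd_mem k, L.fst_ne_snd k⟩, rfl, L.vcc_cone_eq hφ hv k⟩
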